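/- Let $d\ge 0$ and $p\ge 1$ be integers, let $f:\mathbb{R}^d\to\mathbb{R}$ be $\mathcal{C}^{2p}$ and write $T_k=\nabla^k f(x^\star)$ for the symmetric tensor of $k$-th derivatives. Assume that $x^\star$ is a strict polynomial local minimum of $f$ of order $2p$, that is, $x^\star$ is a local minimum and $p$ is the smallest integer $q\ge 1$ for which there is $r>0$ with $\sum_{k=2}^{2q}\frac1{k!}T_k\cdot h^{\otimes k}>0$ for all $0<\|h\|<r$. **Algorithm.** Put $F_0=\mathbb{R}^d$ and, for $1\le k\le p-1$, $F_k=\{h\in F_{k-1}:\ T_{2k}\cdot h\otimes h'^{\otimes 2k-1}=0\ \ \forall h'\in F_{k-1}\}$. Let $E_k^{\mathrm{alg}}$ be the orthogonal complement of $F_k$ in $F_{k-1}$ for $1\le k\le p-1$, and $E_p^{\mathrm{alg}}=F_{p-1}$. **Notation.** For subspaces $E=(E_1,\dots,E_p)$ with $\mathbb{R}^d=E_1\oplus\cdots\oplus E_p$ orthogonally, let $p_{E_j}$ be the orthogonal projection on $E_j$ and $$G_E(h)=\sum_{k=2}^{2p}\frac1{k!}\sum_{\substack{i_1+\cdots+i_p=k\\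 \frac{i_1}{2}+\frac{i_2}{4}+\cdots+\frac{i_p}{2p}=1}}\binom{k}{i_1,\dots,i_p}\,T_k\cdot p_{E_1}(h)^{\otimes i_1}\otimes\cdots\otimes p_{E_p}(h)^{\otimes i_p}.$$ A linear isometry $B$ of $\mathbb{R}^d$ is adapted to $E$ if $Be_i\in E_j$ whenever $\dim E_1+\cdots+\dim E_{j-1}<i\le \dim E_1+\cdots+\dim E_j$; for such $i$ put $\alpha_i=\frac1{2j}$. Let $t^\alpha * h=(t^{\alpha_1}h_1,\dots,t^{\alpha_d}h_d)$. Consider the statements * (A) as $t\to0^+$, $\ \frac1t\big[f\big(x^\star+\sum_{j=1}^p t^{1/(2j)}p_{E_j}(h)\big)-f(x^\star)\big]\to G_E(h)$, uniformly for $h$ in every compact set; * (B) for every $B$ adapted to $E$ and every $h\in\mathbb{R}^d$, $\ \frac1t\big[f(x^\star+B(t^\alpha * h))-f(x^\star)\big]\to g(h):=G_E(Bh)$ as $t\to0^+$; * (C) for every $B$ adapted to $E$, the polynomial $g(h)=G_E(Bh)$ is not constant in any of its variables $h_1,\dots,h_d$: for every $i$ there are two points differing only in the $i$-th coordinate at which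 $g$ takes different values; * (V) for every $h\in\mathbb{R}^d$ and all even $i_1,\dots,i_p\in\{0,2,\dots,2p\}$, not all zero, with $\frac{i_1}2+\cdots+\frac{i_p}{2p}<1$, one has $T_{i_1+\cdots+i_p}\cdot p_{E_1}(h)^{\otimes i_1}\otimes\cdots\otimes p_{E_p}(h)^{\otimes i_p}=0$. **Theorem.** The subspaces $E^{\mathrm{alg}}$ form an orthogonal decomposition of $\mathbb{R}^d$. Moreover: 1. If $p\le 4$, then (A), (B) and (C) hold for $E=E^{\mathrm{alg}}$. 2. If $p\ge5$, then (A) and (B) hold for every orthogonal decomposition $E=(E_1,\dots,E_p)$ of $\mathbb{R}^d$ that satisfies (V). If $E^{\mathrm{alg}}$ satisfies (V), then (C) holds as well for $E=E^{\mathrm{alg}}$. 3. For every $p\ge5$ such subspaces need not exist: there are $d$, $x^\star\in\mathbb{R}^d$ and $f:\mathbb{R}^d\to\mathbb{R}$, of class $\mathcal{C}^{2p}$ with a strict polynomial local minimum of order $2p$ at $x^\star$, such that for $E=E^{\mathrm{alg}}$ the quotient in (A) tends to $+\infty$ as $t\to0^+$ for some $h$, and such that no orthogonal decomposition $E=(E_1,\dots,E_p)$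 of $\mathbb{R}^d$ satisfies both (V) and (C). -/

import Mathlib

open Filter Topology

noncomputable section

/-- `ℝ^d` with its Euclidean norm. -/
abbrev RSpace (d : ℕ) : Type := EuclideanSpace ℝ (Fin d)

/-- The Taylor expansion of order `2q` of `f` at `x` without its terms of order `0` and `1`
is positive on a punctured neighbourhood of `0`. -/
def TaylorPositive {d : ℕ} (f : RSpace d → ℝ) (x : RSpace d) (q : ℕ) : Prop :=
  ∃ r > 0, ∀ h ∈ Metric.ball (0 : RSpace d) r, h ≠ 0 →
    0 < ∑ k ∈ Finset.Icc 2 (2 * q),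
      (1 / (k.factorial : ℝ)) * iteratedFDeriv ℝ k f x (fun _ => h)

/-- `f` is `C^{2p}` and has a strict polynomial local minimum of order `2p` at `x`. -/
structure IsStrictPolyLocalMin {d : ℕ} (p : ℕ) (f : RSpace d → ℝ) (x : RSpace d) : Prop where
  contDiff : ContDiff ℝ ((2 * p : ℕ) : WithTop ℕ∞) f
  isLocalMin : IsLocalMin f x
  isLeast : IsLeast {q : ℕ | 1 ≤ q ∧ TaylorPositive f x q} p

/-- The decreasing subspaces `F_0 = ℝ^d` and
`F_k = {h ∈ F_{k-1} : ∀ h' ∈ F_{k-1}, ∇^{2k} f(x) · h ⊗ h'^{⊗ (2k-1)} = 0}`. -/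
def algF {d : ℕ} (f : RSpace d → ℝ) (x : RSpace d) : ℕ → Submodule ℝ (RSpace d)
  | 0 => ⊤
  | k + 1 =>
    { carrier := {h | h ∈ algF f x k ∧ ∀ h' ∈ algF f x k,
        iteratedFDeriv ℝ (2 * k + 1 + 1) f x (Fin.cons h (fun _ => h')) = 0}
      zero_mem' := ⟨Submodule.zero_mem _, fun h' _ =>
        ContinuousMultilinearMap.map_coord_zero _ 0 (by simp)⟩
      add_mem' := fun {a b} ha hb => ⟨Submodule.add_mem _ ha.1 hb.1, fun h' hh' => by
        rw [ContinuousMultilinearMap.cons_add, ha.2 h' hh', hb.2 h' hh', add_zero]⟩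
      smul_mem' := fun c a ha => ⟨Submodule.smul_mem _ c ha.1, fun h' hh' => by
        rw [ContinuousMultilinearMap.cons_smul, ha.2 h' hh', smul_zero]⟩ }

/-- The subspaces `E_1, …, E_p` built by the algorithm; `algE f x p j` is `E_{j+1}`.
For `k < p`, `E_k` is the orthogonal complement of `F_k` in `F_{k-1}`, and `E_p = F_{p-1}`. -/
def algE {d : ℕ} (f : RSpace d → ℝ) (x : RSpace d) (p : ℕ) (j : Fin p) :
    Submodule ℝ (RSpace d) :=
  if (j : ℕ) + 1 < p then algF f x j ⊓ (algF f x (j + 1))ᗮ else algF f x j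

/-- The `E j` are pairwise orthogonal and `ℝ^d` is their direct sum. -/
def IsOrthDecomp {d p : ℕ} (E : Fin p → Submodule ℝ (RSpace d)) : Prop :=
  (∀ i j, i ≠ j → E i ⟂ E j) ∧ DirectSum.IsInternal E

/-- `i_1 / 2 + i_2 / 4 + ⋯ + i_p / (2p)`. -/
def weight {p : ℕ} (i : Fin p → ℕ) : ℚ :=
  ∑ j : Fin p, (i j : ℚ) / (2 * ((j : ℚ) + 1))

/-- `∇^k f(x) · p_{E_1}(h)^{⊗ i_1} ⊗ ⋯ ⊗ p_{E_p}(h)^{⊗ i_p}` with `k = i_1 + ⋯ + i_p`. -/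
def crossTerm {d p : ℕ} (f : RSpace d → ℝ) (x : RSpace d)
    (E : Fin p → Submodule ℝ (RSpace d)) (i : Fin p → ℕ) (h : RSpace d) : ℝ :=
  iteratedFDeriv ℝ (∑ j, i j) f x
    (fun l => (E (finSigmaFinEquiv.symm l).1).starProjection h)

/-- The limit polynomial: the cross terms of weight one of the Taylor expansion of `f` at `x`. -/
def limitPoly {d p : ℕ} (f : RSpace d → ℝ) (x : RSpace d)
    (E : Fin p → Submodule ℝ (RSpace d)) (h : RSpace d) : ℝ :=
  ∑ k ∈ Finset.Icc 2 (2 * p), (1 / (k.factorial : ℝ)) *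
    ∑ i ∈ (Finset.piAntidiag (Finset.univ : Finset (Fin p)) k).filter (fun i => weight i = 1),
      (Nat.multinomial Finset.univ i : ℝ) * crossTerm f x E i h

/-- `(1/t) [f(x + t^{1/2} p_{E_1}(h) + ⋯ + t^{1/(2p)} p_{E_p}(h)) - f(x)]`. -/
def rescaled {d p : ℕ} (f : RSpace d → ℝ) (x : RSpace d)
    (E : Fin p → Submodule ℝ (RSpace d)) (t : ℝ) (h : RSpace d) : ℝ :=
  (1 / t) * (f (x + ∑ j : Fin p,
    t ^ (1 / (2 * ((j : ℝ) + 1))) • (E j).starProjection h) - f x)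

/-- The rescaled increments converge to `limitPoly`, uniformly on every compact set. -/
def ConvergesOnCompacts {d p : ℕ} (f : RSpace d → ℝ) (x : RSpace d)
    (E : Fin p → Submodule ℝ (RSpace d)) : Prop :=
  ∀ K : Set (RSpace d), IsCompact K →
    TendstoUniformlyOn (rescaled f x E) (limitPoly f x E) (𝓝[>] 0) K

/-- The coordinate `i` (counted from `0`) lies in the block of `E j`:
`∑_{l < j} dim E_l ≤ i < ∑_{l ≤ j} dim E_l`. -/
def InBlock {d p : ℕ} (E : Fin p → Submodule ℝ (RSpace d)) (i : Fin d) (j : Fin p) : Prop :=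
  ∑ l ∈ Finset.Iio j, Module.finrank ℝ (E l) ≤ (i : ℕ) ∧
    (i : ℕ) < ∑ l ∈ Finset.Iic j, Module.finrank ℝ (E l)

/-- The orthogonal transformation `B` is adapted to the decomposition `E`. -/
def IsAdapted {d p : ℕ} (E : Fin p → Submodule ℝ (RSpace d))
    (B : RSpace d ≃ₗᵢ[ℝ] RSpace d) : Prop :=
  ∀ i j, InBlock E i j → B (EuclideanSpace.single i (1 : ℝ)) ∈ E j

open Classical in
/-- `α_i = 1/(2j)` for `i` in the block of `E_j` (each coordinate lies in exactly one block of an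
orthogonal decomposition). -/
def blockExponent {d p : ℕ} (E : Fin p → Submodule ℝ (RSpace d)) (i : Fin d) : ℝ :=
  ∑ j : Fin p, if InBlock E i j then 1 / (2 * ((j : ℝ) + 1)) else 0

/-- `(1/t) [f(x + B · (t^α ∗ h)) - f(x)]`. -/
def rescaledCoord {d p : ℕ} (f : RSpace d → ℝ) (x : RSpace d)
    (E : Fin p → Submodule ℝ (RSpace d)) (B : RSpace d ≃ₗᵢ[ℝ] RSpace d)
    (t : ℝ) (h : RSpace d) : ℝ :=
  (1 / t) * (f (x + B (WithLp.toLp 2 (fun i => t ^ blockExponent E i * h i))) - f x)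

/-- `g` is not constant in any of its variables `h_1, …, h_d`. -/
def NonconstantInEachVariable {d : ℕ} (g : RSpace d → ℝ) : Prop :=
  ∀ i : Fin d, ∃ h h' : RSpace d, (∀ j, j ≠ i → h j = h' j) ∧ g h ≠ g h'

/-- All even cross terms of weight less than one vanish (the term of order `0`, which is the
constant `f(x)`, is not a cross term). -/
def EvenTermsVanish {d p : ℕ} (f : RSpace d → ℝ) (x : RSpace d)
    (E : Fin p → Submodule ℝ (RSpace d)) : Prop :=
  ∀ (h : RSpace d) (i : Fin p → ℕ), (∀ j, Even (i j) ∧ i j ≤ 2 * p) → i ≠ 0 →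
    weight i < 1 → crossTerm f x E i h = 0

end

noncomputable section

/-! Convergence. Moving by `t^{1/(2j)}` along each `E_j` turns the Taylor polynomial into a sum of
`t^w • weightPart w`. The remainder is `o(t)`, because the slowest scale is `t^{1/(2p)}`. So (A)
amounts to the vanishing of every part of weight `w < 1`. If some such part is nonzero, take the
lowest one: it is the limit of `t^{-w}` times increments of `f` from a local minimum, hence
nonnegative. Summed over all sign changes of the `E_j` components, it loses its non-even terms by
cancellation and its even terms by (V); nonnegative values with sum zero are all zero
(`weightPart_eq_zero`). (B) is (A) read in the coordinates of an adapted isometry.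

The algorithm's subspaces. Polarization upgrades the definition of `F_k`: `T_{2k}` vanishes on any
tuple from `F_{k-1}` having one entry in `F_k`. For `p ≤ 4`, arithmetic of the weights shows that
every even cross term of weight below one has this form, so (V) is automatic. For (C), the limit
polynomial on `E_j` is `T_{2j}/(2j)!`. If it were constant along some `v` in `E_j` with `j < p`,
differentiation would put `v` in `F_j`, to which `E_j` is orthogonal. On the last block, positivity
of the Taylor polynomial excludes the degeneracy.

Counterexample. In `(X - Y²)² (X⁴ + Y⁶) + Y^{2p}` the algorithm puts the X-axis in `E_3` and the
Y-axis in `E_5`, but `X²Y⁶` then has weight `2/6 + 6/10 = 14/15 < 1` and the quotient blows up. Any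
other decomposition for which the quotient converges must scale some direction so fast that it
disappears from the limit; hence (V), which implies (A), is incompatible with (C). -/

/-! ### Symmetry of higher derivatives and Taylor's formula -/

/-- Adjacent transpositions generate the symmetric group. One that fixes the first argument is
handled by induction on the order, under the outer derivative; the exchange of the first two
arguments is the symmetry of a second derivative. -/
theorem ContDiff.iteratedFDeriv_apply_comp_perm {E F : Type*} [NormedAddCommGroup E]
    [NormedSpace ℝ E] [NormedAddCommGroup F] [NormedSpace ℝ F] {f : E → F} {n : ℕ}
    (hf : ContDiff ℝ n f) (x : E) (v : Fin n → E) (σ : Equiv.Perm (Fin n)) :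
    iteratedFDeriv ℝ n f x (v ∘ σ) = iteratedFDeriv ℝ n f x v := by
  induction n generalizing x with
  | zero => congr 1; exact Subsingleton.elim _ _
  | succ m ih =>
    have hsucc : ∀ (x : E) (w : Fin (m + 1) → E), iteratedFDeriv ℝ (m + 1) f x w =
        fderiv ℝ (fun y => iteratedFDeriv ℝ m f y (Fin.tail w)) x (w 0) := fun x w =>
      DifferentiableAt.iteratedFDeriv_succ_apply_left'
        ((hf.differentiable_iteratedFDeriv (by exact_mod_cast Nat.lt_succ_self m)) x)
    have hfm : ContDiff ℝ m f := hf.of_le (by exact_mod_cast Nat.le_succ m)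
    have hσ : σ ∈ Submonoid.closure (Set.range fun i : Fin m => Equiv.swap i.castSucc i.succ) := by
      rw [Equiv.Perm.mclosure_swap_castSucc_succ]; trivial
    induction hσ using Submonoid.closure_induction generalizing v with
    | one => rfl
    | mul a b _ _ ha hb => rw [Equiv.Perm.coe_mul, ← Function.comp_assoc, hb, ha]
    | mem s hs =>
      obtain ⟨i, rfl⟩ := hs
      dsimp only
      rcases m with _ | m
      · exact i.elim0
      rcases Fin.eq_zero_or_eq_succ i with rfl | ⟨j, rfl⟩
      · have hg : ∀ w : Fin m → E, ContDiff ℝ 2 (fun z => iteratedFDeriv ℝ m f z w) := fun w => by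
          have h2 := hf.iteratedFDeriv_right (m := 2) (i := m) (by norm_cast; omega)
          exact (ContinuousMultilinearMap.apply ℝ (fun _ : Fin m => E) F w).contDiff.comp h2
        have hsucc' : ∀ (x : E) (w : Fin (m + 1 + 1) → E), iteratedFDeriv ℝ (m + 1 + 1) f x w =
            fderiv ℝ (fderiv ℝ (fun y => iteratedFDeriv ℝ m f y (Fin.tail (Fin.tail w)))) x
              (w 0) (w 1) := fun x w => by
          have h1 : ∀ y, iteratedFDeriv ℝ (m + 1) f y (Fin.tail w) =
              fderiv ℝ (fun y => iteratedFDeriv ℝ m f y (Fin.tail (Fin.tail w))) y (w 1) :=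
            fun y => DifferentiableAt.iteratedFDeriv_succ_apply_left'
              ((hfm.differentiable_iteratedFDeriv (by exact_mod_cast Nat.lt_succ_self m)) y)
          rw [hsucc, funext h1, fderiv_clm_apply _ (by fun_prop)]
          · simp
          · exact ((hg _).fderiv_right (m := 1) (by norm_num)).differentiable (by norm_num) x
        rw [hsucc', hsucc']
        have ht : Fin.tail (Fin.tail (v ∘ Equiv.swap (Fin.castSucc 0) (Fin.succ 0))) =
            Fin.tail (Fin.tail v) := by
          funext l
          simp only [Fin.tail, Function.comp]
          rw [Equiv.swap_apply_of_ne_of_ne] <;> simp [Fin.ext_iff]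
        rw [ht]
        have hs := ((hg (Fin.tail (Fin.tail v))).contDiffAt (x := x)).isSymmSndFDerivAt (by simp)
        have := hs.eq (v 0) (v 1)
        simpa using this.symm
      · rw [hsucc, hsucc]
        have h0 : (v ∘ Equiv.swap (Fin.castSucc j.succ) (Fin.succ j.succ)) 0 = v 0 := by
          simp only [Function.comp]
          rw [Equiv.swap_apply_of_ne_of_ne] <;> simp [Fin.ext_iff]
        have ht : Fin.tail (v ∘ Equiv.swap (Fin.castSucc j.succ) (Fin.succ j.succ)) =
            Fin.tail v ∘ Equiv.swap j.castSucc j.succ := by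
          funext l
          simp only [Fin.tail, Function.comp]
          congr 1
          rw [← Fin.succ_castSucc, Equiv.swap_apply_def, Equiv.swap_apply_def]
          simp only [Fin.succ_inj]
          split_ifs <;> rfl
        rw [h0, ht]
        congr 2
        funext y
        exact ih hfm y _ _

/-- Peano's form follows from the integral remainder of order `n - 1`: subtracting the term of order
`n` leaves an integral of the oscillation of the `n`-th derivative, small by continuity at `x`. -/
theorem ContDiff.taylor_isLittleO_pow {E : Type*} [NormedAddCommGroup E]
    [NormedSpace ℝ E] {f : E → ℝ} {n : ℕ} (hf : ContDiff ℝ n f) (hn : n ≠ 0) (x : E) :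
    (fun h => f (x + h) - f x - ∑ k ∈ Finset.Icc 1 n,
      (1 / (k.factorial : ℝ)) * iteratedFDeriv ℝ k f x (fun _ => h)) =o[𝓝 0]
      fun h => ‖h‖ ^ n := by
  obtain ⟨m, rfl⟩ := Nat.exists_eq_succ_of_ne_zero hn
  rw [Asymptotics.isLittleO_iff]
  intro c hc
  have hcont : Continuous (iteratedFDeriv ℝ (m + 1) f) := hf.continuous_iteratedFDeriv le_rfl
  obtain ⟨δ, hδ, hb⟩ := Metric.continuousAt_iff.1 (hcont.continuousAt (x := x)) c hc
  filter_upwards [Metric.ball_mem_nhds (0 : E) hδ] with h hh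
  have hT := map_add_eq_sum_add_integral_iteratedFDeriv (f := f) (x := x) (y := h) (n := m)
    (fun t _ => hf.contDiffAt)
  have hI : ∫ t in (0 : ℝ)..1, (1 - t) ^ m * iteratedFDeriv ℝ (m + 1) f x (fun _ => h) =
      (1 / (m + 1 : ℝ)) * iteratedFDeriv ℝ (m + 1) f x (fun _ => h) := by
    rw [intervalIntegral.integral_mul_const,
      intervalIntegral.integral_comp_sub_left (fun t : ℝ => t ^ m) 1]
    simp [integral_pow]
  have hsum : f (x + h) - f x - ∑ k ∈ Finset.Icc 1 (m + 1),
      (1 / (k.factorial : ℝ)) * iteratedFDeriv ℝ k f x (fun _ => h) =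
      ((m.factorial : ℝ)⁻¹) * ∫ t in (0 : ℝ)..1, (1 - t) ^ m *
        (iteratedFDeriv ℝ (m + 1) f (x + t • h) (fun _ => h) -
          iteratedFDeriv ℝ (m + 1) f x (fun _ => h)) := by
    have hc1 : Continuous fun t : ℝ => iteratedFDeriv ℝ (m + 1) f (x + t • h) (fun _ => h) := by
      have : Continuous fun t : ℝ => iteratedFDeriv ℝ (m + 1) f (x + t • h) := by fun_prop
      fun_prop
    simp_rw [mul_sub]
    rw [intervalIntegral.integral_sub (Continuous.intervalIntegrable (by fun_prop) _ _)
      (Continuous.intervalIntegrable (by fun_prop) _ _), hI, hT, Finset.sum_range_succ']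
    have hs : ∑ k ∈ Finset.Icc 1 (m + 1),
        (1 / (k.factorial : ℝ)) * iteratedFDeriv ℝ k f x (fun _ => h) =
        ∑ k ∈ Finset.range (m + 1), (1 / ((k + 1).factorial : ℝ)) *
          iteratedFDeriv ℝ (k + 1) f x (fun _ => h) := by
      rw [Finset.range_eq_Ico, Finset.sum_Ico_add' (fun k => (1 / (k.factorial : ℝ)) *
        iteratedFDeriv ℝ k f x (fun _ => h)) 0 (m + 1) 1]
      rfl
    rw [hs, Finset.sum_range_succ]
    simp only [smul_eq_mul, Nat.factorial_zero, Nat.cast_one, inv_one, one_mul,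
      iteratedFDeriv_zero_apply, one_div, Nat.factorial_succ, Nat.cast_mul, Nat.cast_add]
    field_simp
    ring
  rw [hsum, norm_mul, norm_inv, Real.norm_natCast]
  have hle : ‖∫ t in (0 : ℝ)..1, (1 - t) ^ m *
        (iteratedFDeriv ℝ (m + 1) f (x + t • h) (fun _ => h) -
          iteratedFDeriv ℝ (m + 1) f x (fun _ => h))‖ ≤ c * ‖h‖ ^ (m + 1) * |1 - 0| := by
    refine intervalIntegral.norm_integral_le_of_norm_le_const fun t ht => ?_
    rw [Set.uIoc_of_le zero_le_one] at ht
    rw [norm_mul, ← sub_apply]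
    have h1 : ‖(1 - t) ^ m‖ ≤ 1 := by
      rw [norm_pow, Real.norm_eq_abs, abs_of_nonneg (by linarith [ht.2])]
      exact pow_le_one₀ (by linarith [ht.2]) (by linarith [ht.1])
    have h2 := (iteratedFDeriv ℝ (m + 1) f (x + t • h) - iteratedFDeriv ℝ (m + 1) f x).le_opNorm
      (fun _ => h)
    have h3 : ‖iteratedFDeriv ℝ (m + 1) f (x + t • h) - iteratedFDeriv ℝ (m + 1) f x‖ ≤ c := by
      rw [← dist_eq_norm]
      refine (hb ?_).le
      rw [dist_eq_norm, add_sub_cancel_left, norm_smul, Real.norm_eq_abs, abs_of_pos ht.1]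
      have : ‖h‖ < δ := by simpa using hh
      nlinarith [norm_nonneg h, ht.2]
    rw [Finset.prod_const, Finset.card_univ, Fintype.card_fin] at h2
    calc _ ≤ 1 * (c * ‖h‖ ^ (m + 1)) := by
          refine mul_le_mul h1 (h2.trans ?_) (norm_nonneg _) zero_le_one
          exact mul_le_mul_of_nonneg_right h3 (by positivity)
      _ = _ := one_mul _
  have hf1 : ((m.factorial : ℝ))⁻¹ ≤ 1 := inv_le_one_of_one_le₀ (by exact_mod_cast m.factorial_pos)
  rw [Real.norm_of_nonneg (by positivity : (0 : ℝ) ≤ ‖h‖ ^ (m + 1))]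
  calc _ ≤ 1 * (c * ‖h‖ ^ (m + 1) * |1 - 0|) :=
        mul_le_mul hf1 hle (norm_nonneg _) zero_le_one
    _ = _ := by simp

/-! ### Multinomial expansion and polarization -/

/-- The number of times each value is taken by `φ`. -/
def fiberCard {k p : ℕ} (φ : Fin k → Fin p) (j : Fin p) : ℕ :=
  Fintype.card {l // φ l = j}

theorem sum_fiberCard {k p : ℕ} (φ : Fin k → Fin p) : ∑ j, fiberCard φ j = k := by
  simp only [fiberCard]
  rw [← Fintype.card_sigma, Fintype.card_congr (Equiv.sigmaFiberEquiv φ), Fintype.card_fin]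

theorem fiberCard_mem_piAntidiag {k p : ℕ} (φ : Fin k → Fin p) :
    fiberCard φ ∈ Finset.piAntidiag (Finset.univ : Finset (Fin p)) k := by
  simp [sum_fiberCard]

/-- The map `Fin (∑ j, i j) → Fin p` that takes the value `0` first `i 0` times, then `1`
`i 1` times, and so on. -/
def blockMap {p : ℕ} (i : Fin p → ℕ) (l : Fin (∑ j, i j)) : Fin p :=
  (finSigmaFinEquiv.symm l).1

theorem fiberCard_blockMap {p : ℕ} (i : Fin p → ℕ) : fiberCard (blockMap i) = i := by
  funext j
  have e : {l // blockMap i l = j} ≃ {a : (j : Fin p) × Fin (i j) // a.1 = j} :=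
    finSigmaFinEquiv.symm.subtypeEquiv fun l => Iff.rfl
  rw [fiberCard, Fintype.card_congr (e.trans (Equiv.sigmaSubtype j)), Fintype.card_fin]

theorem exists_perm_of_fiberCard_eq {k p : ℕ} {φ ψ : Fin k → Fin p}
    (h : fiberCard φ = fiberCard ψ) : ∃ σ : Equiv.Perm (Fin k), ψ ∘ σ = φ := by
  have e : ∀ j, Nonempty ({l // φ l = j} ≃ {l // ψ l = j}) := fun j =>
    ⟨Fintype.equivOfCardEq (congrFun h j)⟩
  exact ⟨Equiv.ofFiberEquiv fun j => (e j).some, funext fun l => Equiv.ofFiberEquiv_map _ l⟩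

/-- Both sides are the coefficient of the monomial with exponent `i` in `(X_1 + ⋯ + X_p)^k`,
expanded once over words and once by the multinomial theorem. -/
theorem card_fiberCard_eq {k p : ℕ} {i : Fin p → ℕ}
    (hi : i ∈ Finset.piAntidiag (Finset.univ : Finset (Fin p)) k) :
    (Finset.univ.filter fun φ : Fin k → Fin p => fiberCard φ = i).card =
      Nat.multinomial Finset.univ i := by
  have h1 := Finset.sum_pow_eq_sum_piAntidiag (Finset.univ : Finset (Fin p))
    (fun j => (MvPolynomial.X j : MvPolynomial (Fin p) ℕ)) k
  have h2 : (∑ j : Fin p, (MvPolynomial.X j : MvPolynomial (Fin p) ℕ)) ^ k =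
      ∑ φ : Fin k → Fin p, ∏ j, MvPolynomial.X j ^ fiberCard φ j := by
    have h3 : (∑ j : Fin p, (MvPolynomial.X j : MvPolynomial (Fin p) ℕ)) ^ k =
      ∏ _l : Fin k, ∑ j : Fin p, (MvPolynomial.X j : MvPolynomial (Fin p) ℕ) := by simp
    rw [h3, Finset.prod_univ_sum, Fintype.piFinset_univ]
    refine Finset.sum_congr rfl fun φ _ => ?_
    rw [← Finset.prod_fiberwise Finset.univ φ]
    refine Finset.prod_congr rfl fun j _ => ?_
    rw [Finset.prod_congr rfl (g := fun _ => MvPolynomial.X j)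
      (fun l hl => by rw [(Finset.mem_filter.1 hl).2]), Finset.prod_const, fiberCard,
      Fintype.card_subtype]
  have h4 : ∀ a : Fin p → ℕ, MvPolynomial.coeff (Finsupp.equivFunOnFinite.symm i)
      (∏ j, (MvPolynomial.X j : MvPolynomial (Fin p) ℕ) ^ a j) = if a = i then 1 else 0 := by
    intro a
    have : (∏ j, (MvPolynomial.X j : MvPolynomial (Fin p) ℕ) ^ a j) =
        MvPolynomial.monomial (Finsupp.equivFunOnFinite.symm a) 1 := by
      rw [MvPolynomial.monomial_eq, Finsupp.prod_fintype _ _ (by simp)]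
      simp
    rw [this, MvPolynomial.coeff_monomial]
    simp
  have h5 := congrArg (MvPolynomial.coeff (Finsupp.equivFunOnFinite.symm i)) (h2.symm.trans h1)
  rw [MvPolynomial.coeff_sum, MvPolynomial.coeff_sum] at h5
  have h6 : ∀ a : Fin p → ℕ, MvPolynomial.coeff (Finsupp.equivFunOnFinite.symm i)
      ((Nat.multinomial Finset.univ a : MvPolynomial (Fin p) ℕ) *
        ∏ j, (MvPolynomial.X j : MvPolynomial (Fin p) ℕ) ^ a j) =
      if a = i then Nat.multinomial Finset.univ a else 0 := by
    intro a
    rw [← MvPolynomial.C_eq_coe_nat, MvPolynomial.coeff_C_mul, h4]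
    simp
  simp only [h4, h6, Finset.sum_ite_eq', hi, if_true] at h5
  simpa using h5

/-- The multinomial expansion of a symmetric multilinear map. -/
theorem map_sum_eq_sum_piAntidiag {E : Type*} [NormedAddCommGroup E] [NormedSpace ℝ E] {p : ℕ}
    (T : FormalMultilinearSeries ℝ E ℝ) (k : ℕ)
    (hT : ∀ (v : Fin k → E) (σ : Equiv.Perm (Fin k)), T k (v ∘ σ) = T k v) (v : Fin p → E) :
    T k (fun _ => ∑ j, v j) = ∑ i ∈ Finset.piAntidiag (Finset.univ : Finset (Fin p)) k,
      (Nat.multinomial Finset.univ i : ℝ) * T (∑ j, i j) (fun l => v (blockMap i l)) := by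
  rw [(T k).map_sum (fun _ j => v j),
    ← Finset.sum_fiberwise_of_maps_to (g := fiberCard) (fun φ _ => fiberCard_mem_piAntidiag φ)]
  refine Finset.sum_congr rfl fun i hi => ?_
  rw [← card_fiberCard_eq hi, ← nsmul_eq_mul, ← Finset.sum_const]
  refine Finset.sum_congr rfl fun φ hφ => ?_
  have hk : ∑ j, i j = k := (Finset.mem_piAntidiag.1 hi).1
  subst hk
  obtain ⟨σ, rfl⟩ := exists_perm_of_fiberCard_eq
    ((Finset.mem_filter.1 hφ).2.trans (fiberCard_blockMap i).symm)
  exact hT (fun l => v (blockMap i l)) σ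

/-- Polarization: a symmetric multilinear map that vanishes on the diagonal of a submodule
vanishes on the submodule. -/
theorem ContinuousMultilinearMap.eq_zero_of_diagonal_eq_zero {E : Type*} [NormedAddCommGroup E]
    [NormedSpace ℝ E] {n : ℕ} (T : E [×n]→L[ℝ] ℝ)
    (hT : ∀ (v : Fin n → E) (σ : Equiv.Perm (Fin n)), T (v ∘ σ) = T v) (W : Submodule ℝ E)
    (h0 : ∀ w ∈ W, T (fun _ => w) = 0) (v : Fin n → E) (hv : ∀ l, v l ∈ W) : T v = 0 := by
  -- The `n`-th derivative of the diagonal polynomial is a sum over all permutations, which by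
  -- symmetry equals `n! • T v`; on `W` this polynomial is zero.
  have h := (T.compContinuousLinearMap fun _ => W.subtypeL).iteratedFDeriv_comp_diagonal 0
    (fun l => ⟨v l, hv l⟩)
  have h1 : (fun x : W => (T.compContinuousLinearMap fun _ => W.subtypeL) fun _ => x) =
      fun _ => 0 := by
    funext x
    simpa using h0 x x.2
  rw [h1] at h
  have h2 : ∀ σ : Equiv.Perm (Fin n), (T.compContinuousLinearMap fun _ => W.subtypeL)
      (fun l => ⟨v (σ l), hv (σ l)⟩) = T v := fun σ => hT v σ
  rw [Finset.sum_congr rfl fun σ _ => h2 σ] at h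
  have h3 : iteratedFDeriv ℝ n (fun _ : W => (0 : ℝ)) 0 = 0 := by
    rw [iteratedFDeriv_fun_zero]; rfl
  rw [h3] at h
  simpa [Fintype.card_perm, Nat.factorial_ne_zero] using h

/-- If a symmetric multilinear map is constant along a line of the diagonal, its directional
derivative there vanishes. -/
theorem ContinuousMultilinearMap.cons_eq_zero_of_line_const {E : Type*} [NormedAddCommGroup E]
    [NormedSpace ℝ E] {n : ℕ} (T : E [×(n + 1)]→L[ℝ] ℝ)
    (hT : ∀ (v : Fin (n + 1) → E) (σ : Equiv.Perm (Fin (n + 1))), T (v ∘ σ) = T v) (v w : E)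
    (h : ∀ s : ℝ, T (fun _ => w + s • v) = T (fun _ => w)) :
    T (Fin.cons v fun _ => w) = 0 := by
  have h1 : HasDerivAt (fun s : ℝ => T (fun _ => w + s • v))
      (T.linearDeriv (fun _ => w) (fun _ => v)) 0 := by
    have hl : HasDerivAt (fun (s : ℝ) (_ : Fin (n + 1)) => w + s • v) (fun _ => v) 0 := by
      rw [hasDerivAt_pi]
      intro _
      simpa using ((hasDerivAt_id (0 : ℝ)).smul_const v).const_add w
    have hd := T.hasFDerivAt (fun _ => w + (0 : ℝ) • v)
    have := hd.comp_hasDerivAt (0 : ℝ) hl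
    simpa [Function.comp_def] using this
  have h2 : HasDerivAt (fun s : ℝ => T (fun _ => w + s • v)) 0 0 := by
    simp_rw [h]; exact hasDerivAt_const _ _
  have h3 := h1.unique h2
  rw [ContinuousMultilinearMap.linearDeriv_apply] at h3
  -- By symmetry the `n + 1` terms of the derivative along the line coincide, so their common value
  -- is zero.
  have h4 : ∀ i : Fin (n + 1), T (Function.update (fun _ => w) i v) = T (Fin.cons v fun _ => w) := by
    intro i
    rw [← hT (Fin.cons v fun _ => w) (Equiv.swap 0 i)]
    congr 1
    funext l
    by_cases hl : l = i
    · subst hl; simp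
    · rw [Function.update_of_ne hl, Function.comp_apply]
      have hne : Equiv.swap 0 i l ≠ 0 := fun h0 => hl (by
        rw [← Equiv.swap_apply_left 0 i] at h0
        have := congrArg (Equiv.swap 0 i) h0
        simpa using this)
      obtain ⟨m, hm⟩ := Fin.exists_succ_eq.2 hne
      rw [← hm, Fin.cons_succ]
  simp only [h4, Finset.sum_const, Finset.card_univ, Fintype.card_fin, nsmul_eq_mul] at h3
  exact (mul_eq_zero.1 h3).resolve_left (by positivity)

/-! ### Cross terms and their weights -/

theorem IsOrthDecomp.starProjection_of_mem {d p : ℕ} {E : Fin p → Submodule ℝ (RSpace d)}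
    (hE : IsOrthDecomp E) {j : Fin p} {v : RSpace d} (hv : v ∈ E j) (i : Fin p) :
    (E i).starProjection v = if i = j then v else 0 := by
  split_ifs with h
  · subst h; exact Submodule.starProjection_eq_self_iff.2 hv
  · exact (Submodule.starProjection_apply_eq_zero_iff _).2
      ((Submodule.isOrtho_iff_le.1 (hE.1 j i (Ne.symm h))) hv)

theorem IsOrthDecomp.sum_starProjection {d p : ℕ} {E : Fin p → Submodule ℝ (RSpace d)}
    (hE : IsOrthDecomp E) (h : RSpace d) : ∑ j, (E j).starProjection h = h := by
  have hh : h ∈ ⨆ j, E j := by rw [hE.2.submodule_iSup_eq_top]; trivial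
  induction hh using Submodule.iSup_induction' with
  | mem j v hv => simp [hE.starProjection_of_mem hv]
  | zero => simp
  | add a b _ _ ha hb => simp only [map_add, Finset.sum_add_distrib, ha, hb]

theorem IsOrthDecomp.starProjection_sum_smul {d p : ℕ} {E : Fin p → Submodule ℝ (RSpace d)}
    (hE : IsOrthDecomp E) (c : Fin p → ℝ) (h : RSpace d) (i : Fin p) :
    (E i).starProjection (∑ j, c j • (E j).starProjection h) = c i • (E i).starProjection h := by
  rw [map_sum, Finset.sum_eq_single i]
  · rw [map_smul, hE.starProjection_of_mem (Submodule.starProjection_apply_mem _ _), if_pos rfl]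
  · intro j _ hj
    rw [map_smul, hE.starProjection_of_mem (Submodule.starProjection_apply_mem _ _),
      if_neg (Ne.symm hj), smul_zero]
  · simp

theorem crossTerm_eq {d p : ℕ} (f : RSpace d → ℝ) (x : RSpace d)
    (E : Fin p → Submodule ℝ (RSpace d)) (i : Fin p → ℕ) (h : RSpace d) :
    crossTerm f x E i h = iteratedFDeriv ℝ (∑ j, i j) f x
      (fun l => (E (blockMap i l)).starProjection h) := rfl

theorem continuous_crossTerm {d p : ℕ} (f : RSpace d → ℝ) (x : RSpace d)
    (E : Fin p → Submodule ℝ (RSpace d)) (i : Fin p → ℕ) : Continuous (crossTerm f x E i) := by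
  simp only [funext (crossTerm_eq f x E i)]
  exact (ContinuousMultilinearMap.cont _).comp
    (continuous_pi fun l => (E (blockMap i l)).starProjection.continuous)

theorem prod_blockMap {p : ℕ} (i : Fin p → ℕ) (c : Fin p → ℝ) :
    ∏ l, c (blockMap i l) = ∏ j, c j ^ i j := by
  rw [← finSigmaFinEquiv.prod_comp, Fintype.prod_sigma]
  simp [blockMap]

theorem crossTerm_sum_smul {d p : ℕ} (f : RSpace d → ℝ) (x : RSpace d)
    {E : Fin p → Submodule ℝ (RSpace d)} (hE : IsOrthDecomp E) (c : Fin p → ℝ) (i : Fin p → ℕ)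
    (h : RSpace d) : crossTerm f x E i (∑ j, c j • (E j).starProjection h) =
      (∏ j, c j ^ i j) * crossTerm f x E i h := by
  simp only [crossTerm_eq, hE.starProjection_sum_smul]
  rw [ContinuousMultilinearMap.map_smul_univ, prod_blockMap, smul_eq_mul]

/-- The multi-indices of the Taylor expansion of order `2p`, without the constant term. -/
def taylorIndices (p : ℕ) : Finset (Fin p → ℕ) :=
  (Finset.Icc 1 (2 * p)).biUnion fun k => Finset.piAntidiag Finset.univ k

theorem mem_taylorIndices {p : ℕ} {i : Fin p → ℕ} :
    i ∈ taylorIndices p ↔ 1 ≤ ∑ j, i j ∧ ∑ j, i j ≤ 2 * p := by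
  simp [taylorIndices]

/-- The coefficient of a cross term in the Taylor expansion. -/
def taylorCoeff {p : ℕ} (i : Fin p → ℕ) : ℝ :=
  (1 / ((∑ j, i j).factorial : ℝ)) * (Nat.multinomial Finset.univ i : ℝ)

theorem sum_piAntidiag_eq_sum_taylorIndices {p : ℕ} (F : (Fin p → ℕ) → ℝ) :
    ∑ k ∈ Finset.Icc 1 (2 * p), (1 / (k.factorial : ℝ)) *
      ∑ i ∈ Finset.piAntidiag (Finset.univ : Finset (Fin p)) k,
        (Nat.multinomial Finset.univ i : ℝ) * F i =
      ∑ i ∈ taylorIndices p, taylorCoeff i * F i := by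
  rw [taylorIndices, Finset.sum_biUnion]
  · refine Finset.sum_congr rfl fun k _ => ?_
    rw [Finset.mul_sum]
    refine Finset.sum_congr rfl fun i hi => ?_
    rw [taylorCoeff, (Finset.mem_piAntidiag.1 hi).1, mul_assoc]
  · intro a _ b _ hab
    refine Finset.disjoint_left.2 fun i ha hb => hab ?_
    rw [← (Finset.mem_piAntidiag.1 ha).1, ← (Finset.mem_piAntidiag.1 hb).1]

/-- The part of weight `w` of the Taylor expansion of order `2p`. -/
def weightPart {d p : ℕ} (f : RSpace d → ℝ) (x : RSpace d)
    (E : Fin p → Submodule ℝ (RSpace d)) (w : ℚ) (h : RSpace d) : ℝ :=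
  ∑ i ∈ (taylorIndices p).filter (fun i => weight i = w), taylorCoeff i * crossTerm f x E i h

theorem weight_le {p : ℕ} (i : Fin p → ℕ) : weight i ≤ (∑ j, i j : ℕ) / 2 := by
  rw [weight, Nat.cast_sum, Finset.sum_div]
  refine Finset.sum_le_sum fun j _ => ?_
  exact div_le_div_of_nonneg_left (by positivity) (by norm_num)
    (by linarith [(Nat.cast_nonneg (j : ℕ) : (0 : ℚ) ≤ _)])

theorem limitPoly_eq_weightPart {d p : ℕ} (f : RSpace d → ℝ) (x : RSpace d)
    (E : Fin p → Submodule ℝ (RSpace d)) (h : RSpace d) :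
    limitPoly f x E h = weightPart f x E 1 h := by
  have h1 : weightPart f x E 1 h = ∑ i ∈ taylorIndices p, taylorCoeff i *
      (if weight i = 1 then crossTerm f x E i h else 0) := by
    rw [weightPart, Finset.sum_filter]
    exact Finset.sum_congr rfl fun i _ => by split_ifs <;> simp
  rw [h1, ← sum_piAntidiag_eq_sum_taylorIndices, limitPoly]
  have h2 : ∀ k, ∑ i ∈ (Finset.piAntidiag (Finset.univ : Finset (Fin p)) k).filter
      (fun i => weight i = 1), (Nat.multinomial Finset.univ i : ℝ) * crossTerm f x E i h =
      ∑ i ∈ Finset.piAntidiag (Finset.univ : Finset (Fin p)) k,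
        (Nat.multinomial Finset.univ i : ℝ) *
          (if weight i = 1 then crossTerm f x E i h else 0) := by
    intro k
    rw [Finset.sum_filter]
    exact Finset.sum_congr rfl fun i _ => by split_ifs <;> simp
  simp only [h2]
  refine Finset.sum_subset (Finset.Icc_subset_Icc (by norm_num) le_rfl) fun k hk hk' => ?_
  -- `limitPoly` starts at order 2 and `taylorIndices` at order 1; the extra order has weight at
  -- most `1/2`, so it contributes nothing at weight one.
  have hk1 : k = 1 := by simp only [Finset.mem_Icc] at hk hk'; omega
  subst hk1
  rw [Finset.sum_eq_zero, mul_zero]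
  intro i hi
  rw [if_neg, mul_zero]
  intro hw
  have := weight_le i
  rw [hw, (Finset.mem_piAntidiag.1 hi).1] at this
  norm_num at this

theorem continuous_weightPart {d p : ℕ} (f : RSpace d → ℝ) (x : RSpace d)
    (E : Fin p → Submodule ℝ (RSpace d)) (w : ℚ) : Continuous (weightPart f x E w) :=
  continuous_finsetSum _ fun i _ => (continuous_crossTerm f x E i).const_mul _

/-! ### Anisotropic expansion and convergence under (V) -/

/-- The anisotropic dilation of the decomposition `E`. -/
def dilation {d p : ℕ} (E : Fin p → Submodule ℝ (RSpace d)) (t : ℝ) (h : RSpace d) : RSpace d :=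
  ∑ j : Fin p, t ^ (1 / (2 * ((j : ℝ) + 1))) • (E j).starProjection h

/-- The remainder of the Taylor expansion of order `n`. -/
def taylorRemainder {d : ℕ} (f : RSpace d → ℝ) (x : RSpace d) (n : ℕ) (h : RSpace d) : ℝ :=
  f (x + h) - f x - ∑ k ∈ Finset.Icc 1 n,
    (1 / (k.factorial : ℝ)) * iteratedFDeriv ℝ k f x (fun _ => h)

theorem taylor_sum_eq {d p : ℕ} {f : RSpace d → ℝ} (hf : ContDiff ℝ ((2 * p : ℕ) : WithTop ℕ∞) f)
    (x : RSpace d) {E : Fin p → Submodule ℝ (RSpace d)} (hE : IsOrthDecomp E) (h : RSpace d) :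
    ∑ k ∈ Finset.Icc 1 (2 * p), (1 / (k.factorial : ℝ)) * iteratedFDeriv ℝ k f x (fun _ => h) =
      ∑ i ∈ taylorIndices p, taylorCoeff i * crossTerm f x E i h := by
  rw [← sum_piAntidiag_eq_sum_taylorIndices]
  refine Finset.sum_congr rfl fun k hk => ?_
  congr 1
  have hfk : ContDiff ℝ k f := hf.of_le (by exact_mod_cast (Finset.mem_Icc.1 hk).2)
  conv_lhs => rw [← hE.sum_starProjection h]
  exact map_sum_eq_sum_piAntidiag (fun k => iteratedFDeriv ℝ k f x) k
    (fun v σ => hfk.iteratedFDeriv_apply_comp_perm x v σ) _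

theorem prod_rpow_weight {p : ℕ} (i : Fin p → ℕ) {t : ℝ} (ht : 0 < t) :
    ∏ j : Fin p, (t ^ (1 / (2 * ((j : ℝ) + 1)))) ^ i j = t ^ ((weight i : ℚ) : ℝ) := by
  have h1 : ((weight i : ℚ) : ℝ) = ∑ j : Fin p, 1 / (2 * ((j : ℝ) + 1)) * i j := by
    rw [weight]; push_cast
    exact Finset.sum_congr rfl fun j _ => by ring
  rw [h1, Real.rpow_sum_of_pos ht]
  refine Finset.prod_congr rfl fun j _ => ?_
  rw [← Real.rpow_natCast, ← Real.rpow_mul ht.le]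

theorem increment_dilation_eq {d p : ℕ} {f : RSpace d → ℝ}
    (hf : ContDiff ℝ ((2 * p : ℕ) : WithTop ℕ∞) f)
    (x : RSpace d) {E : Fin p → Submodule ℝ (RSpace d)} (hE : IsOrthDecomp E) {t : ℝ} (ht : 0 < t)
    (h : RSpace d) :
    f (x + dilation E t h) - f x =
      ∑ w ∈ (taylorIndices p).image weight, t ^ (w : ℝ) * weightPart f x E w h +
        taylorRemainder f x (2 * p) (dilation E t h) := by
  have h1 : ∑ w ∈ (taylorIndices p).image weight, t ^ (w : ℝ) * weightPart f x E w h =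
      ∑ i ∈ taylorIndices p, taylorCoeff i * crossTerm f x E i (dilation E t h) := by
    rw [← Finset.sum_fiberwise_of_maps_to (g := weight) (t := (taylorIndices p).image weight)
      (fun i hi => Finset.mem_image_of_mem _ hi)]
    refine Finset.sum_congr rfl fun w _ => ?_
    rw [weightPart, Finset.mul_sum]
    refine Finset.sum_congr rfl fun i hi => ?_
    rw [dilation, crossTerm_sum_smul f x hE, prod_rpow_weight i ht, (Finset.mem_filter.1 hi).2]
    ring
  rw [h1, taylorRemainder, taylor_sum_eq hf x hE]
  ring

theorem norm_dilation_pow_le {d p : ℕ} (hp : p ≠ 0) (E : Fin p → Submodule ℝ (RSpace d)) {t : ℝ}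
    (ht : 0 < t) (ht1 : t ≤ 1) {M : ℝ} {h : RSpace d} (hM : ‖h‖ ≤ M) :
    ‖dilation E t h‖ ^ (2 * p) ≤ (p * M) ^ (2 * p) * t := by
  have hp' : (0 : ℝ) < p := by exact_mod_cast Nat.pos_of_ne_zero hp
  have h1 : ‖dilation E t h‖ ≤ (p * M) * t ^ (1 / (2 * (p : ℝ))) := by
    calc ‖dilation E t h‖ ≤ ∑ j : Fin p, M * t ^ (1 / (2 * (p : ℝ))) := by
          refine norm_sum_le_of_le _ fun j _ => ?_
          rw [norm_smul, Real.norm_of_nonneg (by positivity), mul_comm]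
          refine mul_le_mul (((E j).norm_starProjection_apply_le h).trans hM) ?_ (by positivity)
            ((norm_nonneg h).trans hM)
          refine Real.rpow_le_rpow_of_exponent_ge ht ht1 ?_
          refine one_div_le_one_div_of_le (by positivity) ?_
          have : ((j : ℕ) : ℝ) + 1 ≤ p := by exact_mod_cast j.2
          linarith
      _ = _ := by simp; ring
  calc ‖dilation E t h‖ ^ (2 * p) ≤ ((p * M) * t ^ (1 / (2 * (p : ℝ)))) ^ (2 * p) :=
        pow_le_pow_left₀ (norm_nonneg _) h1 _
    _ = _ := by
        rw [mul_pow, ← Real.rpow_natCast (t ^ _), ← Real.rpow_mul ht.le]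
        have : 1 / (2 * (p : ℝ)) * ((2 * p : ℕ) : ℝ) = 1 := by push_cast; field_simp
        rw [this, Real.rpow_one]

/-- After division by `t^w`, higher weights keep a positive power of `t` and are bounded on `K`. The
Taylor remainder is `o(‖dilation‖^{2p}) = o(t)`, negligible because `w ≤ 1`. It is stated for all `w
≤ 1`: the value one gives (A), smaller values give the sign of the lowest part. -/
theorem tendstoUniformlyOn_weightPart {d p : ℕ} (hp : p ≠ 0) {f : RSpace d → ℝ}
    (hf : ContDiff ℝ ((2 * p : ℕ) : WithTop ℕ∞) f)
    (x : RSpace d) {E : Fin p → Submodule ℝ (RSpace d)} (hE : IsOrthDecomp E) {w : ℚ} (hw : w ≤ 1)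
    (h0 : ∀ w' < w, ∀ h, weightPart f x E w' h = 0) {K : Set (RSpace d)} (hK : IsCompact K) :
    TendstoUniformlyOn (fun t h => t ^ (-(w : ℝ)) * (f (x + dilation E t h) - f x))
      (weightPart f x E w) (𝓝[>] 0) K := by
  rw [Metric.tendstoUniformlyOn_iff]
  intro ε hε
  obtain ⟨M, hM⟩ := hK.isBounded.exists_norm_le
  have hB : ∀ w', ∃ B, ∀ h ∈ K, ‖weightPart f x E w' h‖ ≤ B := fun w' =>
    hK.exists_bound_of_continuousOn (continuous_weightPart f x E w').continuousOn
  choose B hB using hB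
  set W := (taylorIndices p).image weight with hW
  have hS : Tendsto (fun t : ℝ => ∑ w' ∈ W, if w < w' then t ^ ((w' : ℝ) - w) * B w' else 0)
      (𝓝[>] 0) (𝓝 0) := by
    have hz : ∑ _w' ∈ W, (0 : ℝ) = 0 := Finset.sum_const_zero
    conv => enter [3]; rw [← hz]
    refine tendsto_finsetSum W fun w' _ => ?_
    split_ifs with hlt
    · have hpos : (0 : ℝ) < (w' : ℝ) - w := sub_pos.2 (by exact_mod_cast hlt)
      have hc := (Real.continuousAt_rpow_const 0 ((w' : ℝ) - w) (Or.inr hpos.le)).tendsto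
      have := (hc.mono_left (nhdsWithin_le_nhds (s := Set.Ioi 0))).mul_const (B w')
      simpa [Real.zero_rpow hpos.ne'] using this
    · exact tendsto_const_nhds
  set C := ((p : ℝ) * M) ^ (2 * p) with hC
  have hC0 : 0 ≤ C := by rw [hC, pow_mul]; positivity
  have hR := Asymptotics.isLittleO_iff.1 (hf.taylor_isLittleO_pow (by omega) x)
    (show 0 < ε / (2 * (C + 1)) by positivity)
  obtain ⟨δ, hδ, hR⟩ := Metric.eventually_nhds_iff.1 hR
  have hsmall : ∀ᶠ t : ℝ in 𝓝[>] 0, C * t < δ ^ (2 * p) := by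
    have : Tendsto (fun t : ℝ => C * t) (𝓝[>] 0) (𝓝 (C * 0)) :=
      (tendsto_id.mono_left nhdsWithin_le_nhds).const_mul C
    exact this.eventually_lt_const (by rw [mul_zero]; positivity)
  filter_upwards [hS.eventually_lt_const (half_pos hε), hsmall, self_mem_nhdsWithin,
    Ioc_mem_nhdsGT (zero_lt_one' ℝ)] with t hSt hst ht ht1 h hh
  have ht : 0 < t := ht
  have hdil := norm_dilation_pow_le hp E ht ht1.2 (hM h hh)
  have hrem : |t ^ (-(w : ℝ)) * taylorRemainder f x (2 * p) (dilation E t h)| < ε / 2 := by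
    have h1 : dist (dilation E t h) 0 < δ := by
      rw [dist_zero_right]
      exact lt_of_pow_lt_pow_left₀ _ hδ.le (hdil.trans_lt hst)
    have h2 := hR h1
    rw [Real.norm_of_nonneg (by positivity : (0 : ℝ) ≤ ‖dilation E t h‖ ^ (2 * p))] at h2
    have h3 : t ^ (-(w : ℝ)) * t ≤ 1 := by
      rw [Real.rpow_neg ht.le, inv_mul_le_one₀ (by positivity)]
      conv_lhs => rw [← Real.rpow_one t]
      exact Real.rpow_le_rpow_of_exponent_ge ht ht1.2 (by exact_mod_cast hw)
    rw [abs_mul, abs_of_pos (Real.rpow_pos_of_pos ht _)]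
    calc t ^ (-(w : ℝ)) * |taylorRemainder f x (2 * p) (dilation E t h)|
        ≤ t ^ (-(w : ℝ)) * (ε / (2 * (C + 1)) * (C * t)) := by
          refine mul_le_mul_of_nonneg_left (h2.trans ?_) (by positivity)
          exact mul_le_mul_of_nonneg_left hdil (by positivity)
      _ = (t ^ (-(w : ℝ)) * t) * (ε / (2 * (C + 1)) * C) := by ring
      _ ≤ 1 * (ε / (2 * (C + 1)) * C) := mul_le_mul_of_nonneg_right h3 (by positivity)
      _ < ε / 2 := by
          rw [one_mul, div_mul_eq_mul_div, div_lt_div_iff₀ (by positivity) (by norm_num)]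
          nlinarith
  have hsplit : t ^ (-(w : ℝ)) * ∑ w' ∈ W, t ^ (w' : ℝ) * weightPart f x E w' h =
      weightPart f x E w h +
        ∑ w' ∈ W, if w < w' then t ^ ((w' : ℝ) - w) * weightPart f x E w' h else 0 := by
    have h1 : weightPart f x E w h = ∑ w' ∈ W, if w' = w then weightPart f x E w h else 0 := by
      rw [Finset.sum_ite_eq']
      split_ifs with hmem
      · rfl
      · rw [weightPart, Finset.sum_eq_zero]
        intro i hi
        exact absurd (hW ▸ Finset.mem_image.2 ⟨i, (Finset.mem_filter.1 hi).1,
          (Finset.mem_filter.1 hi).2⟩) hmem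
    rw [h1, ← Finset.sum_add_distrib, Finset.mul_sum]
    refine Finset.sum_congr rfl fun w' _ => ?_
    rcases lt_trichotomy w' w with hlt | heq | hgt
    · rw [h0 w' hlt, if_neg hlt.ne, if_neg hlt.not_gt]; simp
    · subst heq
      rw [if_pos rfl, if_neg (lt_irrefl _), ← mul_assoc, ← Real.rpow_add ht]
      simp
    · rw [if_neg hgt.ne', if_pos hgt, ← mul_assoc, ← Real.rpow_add ht, zero_add]
      congr 2; ring
  rw [increment_dilation_eq hf x hE ht, mul_add, hsplit, Real.dist_eq, ← abs_neg]
  have hSb : |∑ w' ∈ W, if w < w' then t ^ ((w' : ℝ) - w) * weightPart f x E w' h else 0| ≤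
      ∑ w' ∈ W, if w < w' then t ^ ((w' : ℝ) - w) * B w' else 0 := by
    refine (Finset.abs_sum_le_sum_abs _ _).trans (Finset.sum_le_sum fun w' _ => ?_)
    split_ifs
    · rw [abs_mul, abs_of_pos (Real.rpow_pos_of_pos ht _)]
      exact mul_le_mul_of_nonneg_left (hB w' h hh) (by positivity)
    · simp
  calc _ = |(∑ w' ∈ W, if w < w' then t ^ ((w' : ℝ) - w) * weightPart f x E w' h else 0) +
        t ^ (-(w : ℝ)) * taylorRemainder f x (2 * p) (dilation E t h)| := by
        congr 1; ring
    _ ≤ _ := abs_add_le _ _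
    _ < ε / 2 + ε / 2 := add_lt_add (hSb.trans_lt hSt) hrem
    _ = ε := add_halves ε

theorem tendsto_dilation_zero {d p : ℕ} (E : Fin p → Submodule ℝ (RSpace d)) (h : RSpace d) :
    Tendsto (fun t => dilation E t h) (𝓝[>] 0) (𝓝 0) := by
  rw [show (0 : RSpace d) = ∑ j : Fin p, (0 : ℝ) • (E j).starProjection h by simp]
  refine tendsto_finsetSum _ fun j _ => Tendsto.smul_const ?_ _
  have hpos : (0 : ℝ) < 1 / (2 * ((j : ℝ) + 1)) := by positivity
  have := (Real.continuousAt_rpow_const 0 _ (Or.inr hpos.le)).tendsto.mono_left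
    (nhdsWithin_le_nhds (s := Set.Ioi 0))
  rwa [Real.zero_rpow hpos.ne'] at this

theorem sum_units_prod_pow {p : ℕ} (i : Fin p → ℕ) (hi : ∃ j, ¬ Even (i j)) :
    ∑ ε : Fin p → ℤˣ, ∏ j, (((ε j : ℤˣ) : ℤ) : ℝ) ^ i j = 0 := by
  obtain ⟨j, hj⟩ := hi
  have := Finset.prod_univ_sum (fun _ : Fin p => (Finset.univ : Finset ℤˣ))
    (fun j (e : ℤˣ) => (((e : ℤˣ) : ℤ) : ℝ) ^ i j)
  rw [Fintype.piFinset_univ] at this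
  rw [← this]
  refine Finset.prod_eq_zero (Finset.mem_univ j) ?_
  rw [UnitsInt.univ]
  simp [(Nat.not_even_iff_odd.1 hj).neg_one_pow]

theorem weightPart_nonneg {d p : ℕ} (hp : p ≠ 0) {f : RSpace d → ℝ}
    (hf : ContDiff ℝ ((2 * p : ℕ) : WithTop ℕ∞) f)
    {x : RSpace d} (hx : IsLocalMin f x) {E : Fin p → Submodule ℝ (RSpace d)}
    (hE : IsOrthDecomp E) {w : ℚ} (hw : w ≤ 1)
    (h0 : ∀ w' < w, ∀ h, weightPart f x E w' h = 0) (h : RSpace d) :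
    0 ≤ weightPart f x E w h := by
  have hT := (tendstoUniformlyOn_weightPart hp hf x hE hw h0
    (isCompact_singleton (x := h))).tendsto_at (Set.mem_singleton h)
  refine ge_of_tendsto hT ?_
  have hlim : Tendsto (fun t => x + dilation E t h) (𝓝[>] 0) (𝓝 x) := by
    simpa using (tendsto_dilation_zero E h).const_add x
  filter_upwards [hlim.eventually hx, self_mem_nhdsWithin] with t ht ht0
  exact mul_nonneg (Real.rpow_nonneg (le_of_lt ht0) _) (sub_nonneg.2 ht)

/-- (V) concerns only even exponents; local minimality supplies the rest, through nonnegativity of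
the lowest nonzero part. -/
theorem weightPart_eq_zero {d p : ℕ} (hp : p ≠ 0) {f : RSpace d → ℝ}
    (hf : ContDiff ℝ ((2 * p : ℕ) : WithTop ℕ∞) f)
    {x : RSpace d} (hx : IsLocalMin f x) {E : Fin p → Submodule ℝ (RSpace d)}
    (hE : IsOrthDecomp E) (hV : EvenTermsVanish f x E) {w : ℚ} (hw : w < 1) (h : RSpace d) :
    weightPart f x E w h = 0 := by
  classical
  by_contra hne
  have hmem : ∀ w', (∃ h, weightPart f x E w' h ≠ 0) → w' ∈ (taylorIndices p).image weight := by
    rintro w' ⟨h, hh⟩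
    obtain ⟨i, hi, -⟩ := Finset.exists_ne_zero_of_sum_ne_zero hh
    exact Finset.mem_image.2 ⟨i, (Finset.mem_filter.1 hi).1, (Finset.mem_filter.1 hi).2⟩
  obtain ⟨v, hv, hmin⟩ := Finset.exists_min_image
    (((taylorIndices p).image weight).filter fun w' => w' < 1 ∧ ∃ h, weightPart f x E w' h ≠ 0)
    id ⟨w, Finset.mem_filter.2 ⟨hmem w ⟨h, hne⟩, hw, h, hne⟩⟩
  obtain ⟨-, hv1, g, hg⟩ := Finset.mem_filter.1 hv
  have h0 : ∀ w' < v, ∀ h, weightPart f x E w' h = 0 := by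
    intro w' hw' h
    by_contra hh
    exact absurd (hmin w' (Finset.mem_filter.2
      ⟨hmem w' ⟨h, hh⟩, hw'.trans hv1, h, hh⟩)) (not_le.2 hw')
  have hnonneg := weightPart_nonneg hp hf hx hE hv1.le h0
  -- Summing over independent sign changes of the components cancels each term with an odd exponent;
  -- (V) kills the others. The choice `ε = 1` then recovers `g` itself.
  have hsum : ∑ ε : Fin p → ℤˣ, weightPart f x E v
      (∑ j, (((ε j : ℤˣ) : ℤ) : ℝ) • (E j).starProjection g) = 0 := by
    simp only [weightPart, crossTerm_sum_smul f x hE]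
    rw [Finset.sum_comm]
    refine Finset.sum_eq_zero fun i hi => ?_
    obtain ⟨hi, hiv⟩ := Finset.mem_filter.1 hi
    rw [← Finset.mul_sum, ← Finset.sum_mul]
    by_cases hev : ∀ j, Even (i j)
    · rw [hV g i (fun j => ⟨hev j, ?_⟩) ?_ (hiv ▸ hv1)]
      · simp
      · rintro rfl
        have := (mem_taylorIndices.1 hi).1
        simp at this
      · exact (Finset.single_le_sum (fun _ _ => Nat.zero_le _) (Finset.mem_univ _)).trans
          (mem_taylorIndices.1 hi).2
    · rw [sum_units_prod_pow i (by simpa using hev)]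
      simp
  have := (Finset.sum_eq_zero_iff_of_nonneg (fun ε _ => hnonneg _)).1 hsum 1 (Finset.mem_univ _)
  simp only [Pi.one_apply, Units.val_one, Int.cast_one, one_smul, hE.sum_starProjection] at this
  exact hg this

theorem convergesOnCompacts_of_evenTermsVanish {d p : ℕ} (hp : p ≠ 0) {f : RSpace d → ℝ}
    (hf : ContDiff ℝ ((2 * p : ℕ) : WithTop ℕ∞) f)
    {x : RSpace d} (hx : IsLocalMin f x) {E : Fin p → Submodule ℝ (RSpace d)}
    (hE : IsOrthDecomp E) (hV : EvenTermsVanish f x E) : ConvergesOnCompacts f x E := by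
  intro K hK
  have h := tendstoUniformlyOn_weightPart hp hf x hE le_rfl
    (fun w' hw' h => weightPart_eq_zero hp hf hx hE hV hw' h) hK
  have h1 : limitPoly f x E = weightPart f x E 1 := funext (limitPoly_eq_weightPart f x E)
  rw [h1]
  refine h.congr (Eventually.of_forall fun t h _ => ?_)
  simp only [rescaled, dilation, Rat.cast_one, Real.rpow_neg_one, one_div]

/-! ### Adapted isometries and coordinates -/

theorem IsOrthDecomp.orthogonalFamily {d p : ℕ} {E : Fin p → Submodule ℝ (RSpace d)}
    (hE : IsOrthDecomp E) : OrthogonalFamily ℝ (fun j => E j) fun j => (E j).subtypeₗᵢ :=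
  OrthogonalFamily.of_pairwise fun i j hij => hE.1 i j hij

/-- An orthonormal basis made of orthonormal bases of the subspaces of the decomposition. -/
def IsOrthDecomp.sigmaBasis {d p : ℕ} {E : Fin p → Submodule ℝ (RSpace d)}
    (hE : IsOrthDecomp E) :
    OrthonormalBasis ((j : Fin p) × Fin (Module.finrank ℝ (E j))) ℝ (RSpace d) :=
  hE.2.collectedOrthonormalBasis hE.orthogonalFamily fun j => stdOrthonormalBasis ℝ (E j)

theorem IsOrthDecomp.sigmaBasis_mem {d p : ℕ} {E : Fin p → Submodule ℝ (RSpace d)}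
    (hE : IsOrthDecomp E) (a : (j : Fin p) × Fin (Module.finrank ℝ (E j))) :
    hE.sigmaBasis a ∈ E a.1 :=
  hE.2.collectedOrthonormalBasis_mem hE.orthogonalFamily _ a

theorem IsOrthDecomp.sum_finrank {d p : ℕ} {E : Fin p → Submodule ℝ (RSpace d)}
    (hE : IsOrthDecomp E) : ∑ j, Module.finrank ℝ (E j) = d := by
  have h := Module.finrank_eq_card_basis hE.sigmaBasis.toBasis
  rw [finrank_euclideanSpace_fin, Fintype.card_sigma] at h
  simpa using h.symm

/-- The coordinates in the order of the blocks of the decomposition. -/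
def IsOrthDecomp.coordEquiv {d p : ℕ} {E : Fin p → Submodule ℝ (RSpace d)}
    (hE : IsOrthDecomp E) : ((j : Fin p) × Fin (Module.finrank ℝ (E j))) ≃ Fin d :=
  finSigmaFinEquiv.trans (finCongr hE.sum_finrank)

theorem inBlock_unique {d p : ℕ} {E : Fin p → Submodule ℝ (RSpace d)} {i : Fin d} {j j' : Fin p}
    (h : InBlock E i j) (h' : InBlock E i j') : j = j' := by
  have key : ∀ {a b : Fin p}, InBlock E i a → InBlock E i b → ¬ a < b := fun {a b} ha hb hab => by
    have hsub : Finset.Iic a ⊆ Finset.Iio b := fun l hl =>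
      Finset.mem_Iio.2 ((Finset.mem_Iic.1 hl).trans_lt hab)
    have := Finset.sum_le_sum_of_subset (f := fun l => Module.finrank ℝ (E l)) hsub
    have h1 := ha.2
    have h2 := hb.1
    omega
  exact le_antisymm (not_lt.1 (key h' h)) (not_lt.1 (key h h'))

theorem IsOrthDecomp.inBlock_coordEquiv {d p : ℕ} {E : Fin p → Submodule ℝ (RSpace d)}
    (hE : IsOrthDecomp E) (a : (j : Fin p) × Fin (Module.finrank ℝ (E j))) :
    InBlock E (hE.coordEquiv a) a.1 := by
  have h1 : ((hE.coordEquiv a : Fin d) : ℕ) =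
      ∑ l ∈ Finset.Iio a.1, Module.finrank ℝ (E l) + a.2 := by
    rw [coordEquiv, Equiv.trans_apply, finCongr_apply, Fin.val_cast, finSigmaFinEquiv_apply]
    congr 1
    have h2 : (Finset.univ : Finset (Fin a.1)).map (Fin.castLEEmb a.1.2.le) = Finset.Iio a.1 := by
      ext l
      simp only [Finset.mem_map, Finset.mem_univ, true_and, Finset.mem_Iio]
      constructor
      · rintro ⟨m, rfl⟩
        exact Fin.lt_def.2 m.2
      · intro hl
        exact ⟨⟨l, Fin.lt_def.1 hl⟩, rfl⟩
    rw [← h2, Finset.sum_map]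
    rfl
  refine ⟨by omega, ?_⟩
  have h3 : Finset.Iic a.1 = insert a.1 (Finset.Iio a.1) := by
    rw [Finset.Iio_insert]
  rw [h3, Finset.sum_insert (by simp)]
  have := a.2.2
  omega

theorem IsOrthDecomp.exists_inBlock {d p : ℕ} {E : Fin p → Submodule ℝ (RSpace d)}
    (hE : IsOrthDecomp E) (i : Fin d) : ∃ j, InBlock E i j :=
  ⟨_, by simpa using hE.inBlock_coordEquiv (hE.coordEquiv.symm i)⟩

theorem IsOrthDecomp.exists_isAdapted {d p : ℕ} {E : Fin p → Submodule ℝ (RSpace d)}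
    (hE : IsOrthDecomp E) : ∃ B : RSpace d ≃ₗᵢ[ℝ] RSpace d, IsAdapted E B := by
  refine ⟨(hE.sigmaBasis.reindex hE.coordEquiv).repr.symm, fun i j hij => ?_⟩
  rw [OrthonormalBasis.repr_symm_single, OrthonormalBasis.reindex_apply]
  have := hE.inBlock_coordEquiv (hE.coordEquiv.symm i)
  rw [Equiv.apply_symm_apply] at this
  rw [inBlock_unique hij this]
  exact hE.sigmaBasis_mem _

theorem blockExponent_eq {d p : ℕ} {E : Fin p → Submodule ℝ (RSpace d)} {i : Fin d} {j : Fin p}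
    (h : InBlock E i j) : blockExponent E i = 1 / (2 * ((j : ℝ) + 1)) := by
  rw [blockExponent, Finset.sum_eq_single j]
  · rw [if_pos h]
  · intro l _ hl
    rw [if_neg fun h' => hl (inBlock_unique h' h)]
  · simp

theorem IsOrthDecomp.dilation_of_mem {d p : ℕ} {E : Fin p → Submodule ℝ (RSpace d)}
    (hE : IsOrthDecomp E) {j : Fin p} {v : RSpace d} (hv : v ∈ E j) (t : ℝ) :
    dilation E t v = t ^ (1 / (2 * ((j : ℝ) + 1))) • v := by
  rw [dilation, Finset.sum_eq_single j]
  · rw [hE.starProjection_of_mem hv, if_pos rfl]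
  · intro l _ hl
    rw [hE.starProjection_of_mem hv, if_neg hl, smul_zero]
  · simp

theorem dilation_add {d p : ℕ} (E : Fin p → Submodule ℝ (RSpace d)) (t : ℝ) (u v : RSpace d) :
    dilation E t (u + v) = dilation E t u + dilation E t v := by
  simp [dilation, Finset.sum_add_distrib]

theorem dilation_smul {d p : ℕ} (E : Fin p → Submodule ℝ (RSpace d)) (t c : ℝ) (v : RSpace d) :
    dilation E t (c • v) = c • dilation E t v := by
  simp only [dilation, map_smul, Finset.smul_sum]
  exact Finset.sum_congr rfl fun j _ => smul_comm _ _ _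

theorem dilation_sum {d p : ℕ} (E : Fin p → Submodule ℝ (RSpace d)) (t : ℝ) {ι : Type*}
    (s : Finset ι) (v : ι → RSpace d) :
    dilation E t (∑ i ∈ s, v i) = ∑ i ∈ s, dilation E t (v i) := by
  simp only [dilation, map_sum, Finset.smul_sum]
  exact Finset.sum_comm

theorem euclideanSpace_eq_sum_single {d : ℕ} (h : RSpace d) :
    h = ∑ i, h i • EuclideanSpace.single i (1 : ℝ) := by
  ext l
  simp [Finset.sum_apply, Pi.single_apply]

theorem IsOrthDecomp.map_dilation {d p : ℕ} {E : Fin p → Submodule ℝ (RSpace d)}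
    (hE : IsOrthDecomp E) {B : RSpace d ≃ₗᵢ[ℝ] RSpace d} (hB : IsAdapted E B) (t : ℝ)
    (h : RSpace d) :
    B (WithLp.toLp 2 (fun i => t ^ blockExponent E i * h i)) = dilation E t (B h) := by
  conv_rhs => rw [euclideanSpace_eq_sum_single h]
  rw [euclideanSpace_eq_sum_single (WithLp.toLp 2 (fun i => t ^ blockExponent E i * h i)),
    map_sum, map_sum, dilation_sum]
  refine Finset.sum_congr rfl fun i _ => ?_
  obtain ⟨j, hj⟩ := hE.exists_inBlock i
  rw [map_smul, map_smul, dilation_smul, hE.dilation_of_mem (hB i j hj), smul_smul, mul_comm,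
    ← blockExponent_eq hj]

theorem rescaledCoord_eq {d p : ℕ} (f : RSpace d → ℝ) (x : RSpace d)
    {E : Fin p → Submodule ℝ (RSpace d)} (hE : IsOrthDecomp E) {B : RSpace d ≃ₗᵢ[ℝ] RSpace d}
    (hB : IsAdapted E B) (t : ℝ) (h : RSpace d) :
    rescaledCoord f x E B t h = rescaled f x E t (B h) := by
  rw [rescaledCoord, hE.map_dilation hB, rescaled, dilation]

theorem ConvergesOnCompacts.tendsto {d p : ℕ} {f : RSpace d → ℝ} {x : RSpace d}
    {E : Fin p → Submodule ℝ (RSpace d)} (h : ConvergesOnCompacts f x E) (v : RSpace d) :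
    Tendsto (fun t => rescaled f x E t v) (𝓝[>] 0) (𝓝 (limitPoly f x E v)) :=
  (h {v} isCompact_singleton).tendsto_at (Set.mem_singleton v)

theorem ConvergesOnCompacts.tendsto_rescaledCoord {d p : ℕ} {f : RSpace d → ℝ} {x : RSpace d}
    {E : Fin p → Submodule ℝ (RSpace d)} (h : ConvergesOnCompacts f x E) (hE : IsOrthDecomp E)
    {B : RSpace d ≃ₗᵢ[ℝ] RSpace d} (hB : IsAdapted E B) (v : RSpace d) :
    Tendsto (fun t => rescaledCoord f x E B t v) (𝓝[>] 0) (𝓝 (limitPoly f x E (B v))) := by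
  simp only [rescaledCoord_eq f x hE hB]
  exact h.tendsto (B v)

/-! ### The algorithm's subspaces and nonconstancy -/

theorem algF_succ_le {d : ℕ} (f : RSpace d → ℝ) (x : RSpace d) (k : ℕ) :
    algF f x (k + 1) ≤ algF f x k := fun _ h => h.1

theorem algF_antitone {d : ℕ} (f : RSpace d → ℝ) (x : RSpace d) : Antitone (algF f x) :=
  antitone_nat_of_succ_le (algF_succ_le f x)

theorem algE_le_algF {d : ℕ} (f : RSpace d → ℝ) (x : RSpace d) (p : ℕ) (j : Fin p) :
    algE f x p j ≤ algF f x j := by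
  rw [algE]
  split_ifs
  · exact inf_le_left
  · exact le_rfl

theorem isOrthDecomp_algE {d p : ℕ} (hp : p ≠ 0) (f : RSpace d → ℝ) (x : RSpace d) :
    IsOrthDecomp (algE f x p) := by
  have key : ∀ i j : Fin p, i < j → algE f x p i ⟂ algE f x p j := by
    intro i j hij
    have hi : (i : ℕ) + 1 < p := by have := Fin.lt_def.1 hij; omega
    have h1 : algE f x p i ≤ (algF f x (i + 1))ᗮ := by
      rw [algE, if_pos hi]; exact inf_le_right
    have h2 : algE f x p j ≤ algF f x (i + 1) :=
      (algE_le_algF f x p j).trans (algF_antitone f x (Fin.lt_def.1 hij))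
    exact (Submodule.isOrtho_orthogonal_left _).mono h1 h2
  have horth : ∀ i j : Fin p, i ≠ j → algE f x p i ⟂ algE f x p j := by
    intro i j hij
    rcases lt_or_gt_of_ne hij with h | h
    · exact key i j h
    · exact (key j i h).symm
  refine ⟨horth, ?_⟩
  have hfam : OrthogonalFamily ℝ (fun j => algE f x p j) fun j => (algE f x p j).subtypeₗᵢ :=
    OrthogonalFamily.of_pairwise fun i j hij => horth i j hij
  rw [hfam.isInternal_iff, Submodule.orthogonal_eq_bot_iff, eq_top_iff]
  -- Induction downwards from `F_{p-1} = E_p`, splitting `F_n` as `F_{n+1}` plus its orthogonal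
  -- complement in `F_n`.
  have hle : ∀ m n, n + m + 1 = p → algF f x n ≤ ⨆ j, algE f x p j := by
    intro m
    induction m with
    | zero =>
      intro n hn
      refine le_trans (le_of_eq ?_) (le_iSup (algE f x p) ⟨n, by omega⟩)
      rw [algE, if_neg (by simp; omega)]
    | succ m ih =>
      intro n hn
      rw [← Submodule.sup_orthogonal_inf_of_hasOrthogonalProjection (algF_succ_le f x n)]
      refine sup_le (ih (n + 1) (by omega)) (le_trans (le_of_eq ?_)
        (le_iSup (algE f x p) ⟨n, by omega⟩))
      rw [algE, if_pos (by simp; omega), inf_comm]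
  exact hle (p - 1) 0 (by omega)

theorem curryLeft_comp_perm {d n : ℕ} (T : (RSpace d) [×(n + 1)]→L[ℝ] ℝ)
    (hT : ∀ (v : Fin (n + 1) → RSpace d) (σ : Equiv.Perm (Fin (n + 1))), T (v ∘ σ) = T v)
    (a : RSpace d) (v : Fin n → RSpace d) (σ : Equiv.Perm (Fin n)) :
    T.curryLeft a (v ∘ σ) = T.curryLeft a v := by
  -- The pair `(0, σ)` encodes the permutation that fixes the first slot and acts by `σ` on the
  -- others.
  rw [ContinuousMultilinearMap.curryLeft_apply, ContinuousMultilinearMap.curryLeft_apply,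
    ← hT (Fin.cons a v) (Equiv.Perm.decomposeFin.symm (0, σ))]
  congr 1
  funext l
  refine Fin.cases ?_ (fun m => ?_) l
  · simp
  · simp [Equiv.Perm.decomposeFin_symm_apply_succ]

/-- The definition of `F_{k+1}` tests only equal remaining arguments; symmetry and polarization
extend it to arbitrary arguments in `F_k` and to any slot. The order `n` is a variable so that the
lemma applies to sums such as `∑ j, i j` without casts. -/
theorem iteratedFDeriv_eq_zero_of_mem_algF {d n k : ℕ} {f : RSpace d → ℝ} {x : RSpace d}
    (hn : n = 2 * k + 1 + 1) (hf : ContDiff ℝ n f) (v : Fin n → RSpace d)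
    (hv : ∀ l, v l ∈ algF f x k) (l₀ : Fin n) (h₀ : v l₀ ∈ algF f x (k + 1)) :
    iteratedFDeriv ℝ n f x v = 0 := by
  subst hn
  have hT := fun (v : Fin (2 * k + 1 + 1) → RSpace d) σ => hf.iteratedFDeriv_apply_comp_perm x v σ
  rw [← hT v (Equiv.swap 0 l₀)]
  have hcons : v ∘ Equiv.swap 0 l₀ = Fin.cons (v l₀) (Fin.tail (v ∘ Equiv.swap 0 l₀)) := by
    rw [← Fin.cons_self_tail (v ∘ Equiv.swap 0 l₀)]
    simp
  rw [hcons, ← ContinuousMultilinearMap.curryLeft_apply]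
  refine ContinuousMultilinearMap.eq_zero_of_diagonal_eq_zero _ (curryLeft_comp_perm _ hT _)
    (algF f x k) (fun w hw => ?_) _ (fun l => hv _)
  rw [ContinuousMultilinearMap.curryLeft_apply]
  exact h₀.2 w hw

theorem iteratedFDeriv_smul_diagonal {d : ℕ} (f : RSpace d → ℝ) (x : RSpace d) (k : ℕ) (c : ℝ)
    (v : RSpace d) : iteratedFDeriv ℝ k f x (fun _ => c • v) =
      c ^ k * iteratedFDeriv ℝ k f x (fun _ => v) := by
  rw [ContinuousMultilinearMap.map_smul_univ]
  simp

theorem exists_blockMap_eq {p : ℕ} {i : Fin p → ℕ} {j : Fin p} (h : i j ≠ 0) :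
    ∃ l, blockMap i l = j :=
  ⟨finSigmaFinEquiv ⟨j, ⟨0, Nat.pos_of_ne_zero h⟩⟩, by simp [blockMap]⟩

theorem blockMap_ne_zero {p : ℕ} (i : Fin p → ℕ) (l : Fin (∑ j, i j)) : i (blockMap i l) ≠ 0 :=
  fun h => (Fin.cast h (finSigmaFinEquiv.symm l).2).elim0

theorem weight_single {p : ℕ} (j : Fin p) (k : ℕ) :
    weight (Pi.single j k) = (k : ℚ) / (2 * ((j : ℚ) + 1)) := by
  rw [weight, Finset.sum_eq_single j]
  · simp
  · intro l _ hl
    simp [Pi.single_eq_of_ne hl]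
  · simp

/-- A cross term involving another block has a zero argument, and within one block weight one forces
the degree. -/
theorem limitPoly_of_mem {d p : ℕ} (f : RSpace d → ℝ) (x : RSpace d)
    {E : Fin p → Submodule ℝ (RSpace d)} (hE : IsOrthDecomp E) {j : Fin p} {v : RSpace d}
    (hv : v ∈ E j) {n : ℕ} (hn : n = 2 * ((j : ℕ) + 1)) : limitPoly f x E v =
      (1 / (n.factorial : ℝ)) * iteratedFDeriv ℝ n f x (fun _ => v) := by
  have hw : weight (Pi.single j n : Fin p → ℕ) = 1 := by
    rw [weight_single, hn]; push_cast; exact div_self (by positivity)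
  have hsum : ∑ l, (Pi.single j n : Fin p → ℕ) l = n := by simp
  rw [limitPoly_eq_weightPart, weightPart, Finset.sum_eq_single (Pi.single j n)]
  · rw [taylorCoeff, hsum, Nat.multinomial_single, Nat.cast_one, mul_one]
    congr 1
    rw [crossTerm_eq]
    have hb : (fun l => (E (blockMap (Pi.single j n) l)).starProjection v) = fun _ => v := by
      funext l
      have := blockMap_ne_zero (Pi.single j n) l
      rw [Pi.single_apply] at this
      rw [hE.starProjection_of_mem hv, if_pos]
      by_contra h
      simp [h] at this
    rw [hb, hsum]
  · intro i hi hne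
    have hex : ∃ l, l ≠ j ∧ i l ≠ 0 := by
      by_contra hcon
      push Not at hcon
      apply hne
      have hi1 : i = Pi.single j (i j) := by
        funext l
        by_cases hl : l = j
        · subst hl; simp
        · rw [Pi.single_eq_of_ne hl, hcon l hl]
      have h1 := (Finset.mem_filter.1 hi).2
      rw [hi1, weight_single, div_eq_one_iff_eq (by positivity)] at h1
      have h2 : i j = n := by rw [hn]; exact_mod_cast h1
      rw [hi1, h2]
    obtain ⟨l, hl, hil⟩ := hex
    obtain ⟨m, hm⟩ := exists_blockMap_eq hil
    rw [crossTerm_eq, ContinuousMultilinearMap.map_coord_zero _ m, mul_zero]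
    rw [hE.starProjection_of_mem hv, hm, if_neg hl]
  · intro h
    refine absurd (Finset.mem_filter.2 ⟨mem_taylorIndices.2 ?_, hw⟩) h
    rw [hsum]
    have := j.2
    omega

/-- Add the positive Taylor sums at `t • v` and `-t • v`: odd orders cancel, and even orders below
`2p` vanish on `F_{p-1}`. If order `2p` vanished too, the sum would be zero. -/
theorem iteratedFDeriv_diagonal_ne_zero_of_last {d p : ℕ} {f : RSpace d → ℝ} {x : RSpace d}
    (hx : IsStrictPolyLocalMin p f x) {n : ℕ} (hn : n + 1 = p) {v : RSpace d}
    (hv : v ∈ algF f x n) (hv0 : v ≠ 0) : iteratedFDeriv ℝ (2 * p) f x (fun _ => v) ≠ 0 := by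
  intro hzero
  obtain ⟨r, hr, hpos⟩ := hx.isLeast.1.2
  obtain ⟨t, ht, htr⟩ : ∃ t : ℝ, 0 < t ∧ ‖t • v‖ < r := by
    have hc : Tendsto (fun t : ℝ => ‖t • v‖) (𝓝[>] 0) (𝓝 ‖(0 : ℝ) • v‖) :=
      ((continuous_id.smul continuous_const).norm.tendsto 0).mono_left nhdsWithin_le_nhds
    rw [zero_smul, norm_zero] at hc
    obtain ⟨t, h1, h2⟩ := ((hc.eventually_lt_const hr).and self_mem_nhdsWithin).exists
    exact ⟨t, h2, h1⟩
  have h1 := hpos (t • v) (by simpa using htr) (smul_ne_zero ht.ne' hv0)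
  have h2 := hpos (-t • v) (by simpa [neg_smul] using htr) (smul_ne_zero (neg_ne_zero.2 ht.ne') hv0)
  have h3 := add_pos h1 h2
  rw [← Finset.sum_add_distrib] at h3
  refine h3.ne' (Finset.sum_eq_zero fun k hk => ?_)
  simp only [iteratedFDeriv_smul_diagonal]
  rcases Nat.even_or_odd k with ⟨m, hm⟩ | hodd
  · have hT : iteratedFDeriv ℝ k f x (fun _ => v) = 0 := by
      obtain ⟨hk2, hkp⟩ := Finset.mem_Icc.1 hk
      rcases hkp.eq_or_lt with rfl | hlt
      · exact hzero
      · refine iteratedFDeriv_eq_zero_of_mem_algF (k := m - 1) (by omega)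
          (hx.contDiff.of_le (by exact_mod_cast hkp)) _
          (fun _ => algF_antitone f x (by omega) hv) ⟨0, by omega⟩
          (algF_antitone f x (by omega) hv)
    simp [hT]
  · rw [hodd.neg_pow]; ring

/-- Invariance along `v` within its block would give `T(v, w, …, w) = 0` for all `w` in the block.
Before the last block this places `v` in the next `F`, to which it is orthogonal; on the last block,
comparing the values at `0` and `v` suffices. -/
theorem exists_limitPoly_ne {d p : ℕ} {f : RSpace d → ℝ} {x : RSpace d}
    (hx : IsStrictPolyLocalMin p f x) {j : Fin p} {v : RSpace d} (hv : v ∈ algE f x p j)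
    (hv0 : v ≠ 0) : ∃ (w : RSpace d) (s : ℝ),
      limitPoly f x (algE f x p) (w + s • v) ≠ limitPoly f x (algE f x p) w := by
  have hp : p ≠ 0 := by have := hx.isLeast.1.1; omega
  have hE := isOrthDecomp_algE hp f x
  have hsym : ContDiff ℝ ((2 * (j : ℕ) + 1 + 1 : ℕ) : WithTop ℕ∞) f :=
    hx.contDiff.of_le (by have := j.2; exact_mod_cast (by omega : 2 * (j : ℕ) + 1 + 1 ≤ 2 * p))
  have hT := fun (v : Fin (2 * (j : ℕ) + 1 + 1) → RSpace d) σ =>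
    hsym.iteratedFDeriv_apply_comp_perm x v σ
  suffices h : ∃ w ∈ algE f x p j, ∃ s : ℝ,
      iteratedFDeriv ℝ (2 * (j : ℕ) + 1 + 1) f x (fun _ => w + s • v) ≠
        iteratedFDeriv ℝ (2 * (j : ℕ) + 1 + 1) f x (fun _ => w) by
    obtain ⟨w, hw, s, hs⟩ := h
    refine ⟨w, s, ?_⟩
    rw [limitPoly_of_mem f x hE (add_mem hw (Submodule.smul_mem _ s hv))
      (n := 2 * (j : ℕ) + 1 + 1) (by ring), limitPoly_of_mem f x hE hw
      (n := 2 * (j : ℕ) + 1 + 1) (by ring)]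
    intro heq
    exact hs (mul_left_cancel₀ (by positivity) heq)
  by_cases hj : (j : ℕ) + 1 < p
  · have hvF := hv
    rw [algE, if_pos hj] at hvF
    by_contra hcon
    push Not at hcon
    have hdiag : ∀ w ∈ algE f x p j,
        iteratedFDeriv ℝ (2 * (j : ℕ) + 1 + 1) f x (Fin.cons v fun _ => w) = 0 := fun w hw =>
      ContinuousMultilinearMap.cons_eq_zero_of_line_const _ hT v w (hcon w hw)
    have hvmem : v ∈ algF f x (j + 1) := by
      refine ⟨hvF.1, fun h' hh' => ?_⟩
      have hdec := Submodule.sup_orthogonal_inf_of_hasOrthogonalProjection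
        (algF_succ_le f x (j : ℕ))
      rw [← hdec] at hh'
      obtain ⟨b, hb, a, ha, rfl⟩ := Submodule.mem_sup.1 hh'
      have haE : a ∈ algE f x p j := by rw [algE, if_pos hj, inf_comm]; exact ha
      rw [← ContinuousMultilinearMap.curryLeft_apply]
      change (iteratedFDeriv ℝ (2 * (j : ℕ) + 1 + 1) f x).curryLeft v
        ((fun _ => b) + fun _ => a) = 0
      -- Here `b` is in the next `F` and `a` in the block. The pure `a` term vanishes by `hdiag`;
      -- any term with an entry `b` vanishes by the definition of the next `F`.
      rw [ContinuousMultilinearMap.map_add_univ]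
      refine Finset.sum_eq_zero fun S _ => ?_
      rw [ContinuousMultilinearMap.curryLeft_apply]
      rcases S.eq_empty_or_nonempty with rfl | ⟨l, hl⟩
      · rw [Finset.piecewise_empty]
        exact hdiag a haE
      · refine iteratedFDeriv_eq_zero_of_mem_algF (k := j) rfl hsym _ (fun m => ?_) l.succ ?_
        · refine Fin.cases ?_ (fun m => ?_) m
          · exact hvF.1
          · rw [Fin.cons_succ, Finset.piecewise]
            split_ifs
            · exact hb.1
            · exact ha.2
        · rw [Fin.cons_succ, Finset.piecewise_eq_of_mem _ _ _ hl]
          exact hb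
    exact hv0 (inner_self_eq_zero.1 (hvF.2 v hvmem))
  · have hjp : (j : ℕ) + 1 = p := by have := j.2; omega
    refine ⟨0, zero_mem _, 1, ?_⟩
    have h0 : iteratedFDeriv ℝ (2 * (j : ℕ) + 1 + 1) f x (fun _ => 0) = 0 :=
      ContinuousMultilinearMap.map_coord_zero _ 0 rfl
    rw [h0]
    have h := iteratedFDeriv_diagonal_ne_zero_of_last hx hjp (algE_le_algF f x p j hv) hv0
    have h2 : 2 * p = 2 * (j : ℕ) + 1 + 1 := by omega
    rw [h2] at h
    simpa using h

theorem nonconstantInEachVariable_algE {d p : ℕ} {f : RSpace d → ℝ} {x : RSpace d}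
    (hx : IsStrictPolyLocalMin p f x) {B : RSpace d ≃ₗᵢ[ℝ] RSpace d}
    (hB : IsAdapted (algE f x p) B) :
    NonconstantInEachVariable (fun h => limitPoly f x (algE f x p) (B h)) := by
  intro i
  have hp : p ≠ 0 := by have := hx.isLeast.1.1; omega
  obtain ⟨j, hj⟩ := (isOrthDecomp_algE hp f x).exists_inBlock i
  have hne : B (EuclideanSpace.single i (1 : ℝ)) ≠ 0 := by
    rw [Ne, LinearIsometryEquiv.map_eq_zero_iff]
    simp
  obtain ⟨w, s, hws⟩ := exists_limitPoly_ne hx (hB i j hj) hne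
  refine ⟨B.symm w + s • EuclideanSpace.single i (1 : ℝ), B.symm w, fun l hl => ?_, ?_⟩
  · simp [hl]
  · simpa using hws

/-! ### Automatic vanishing for orders at most eight -/

theorem evenTermsVanish_algE_of_le_four {d p : ℕ} (hp : p ≤ 4) {f : RSpace d → ℝ} {x : RSpace d}
    (hf : ContDiff ℝ ((2 * p : ℕ) : WithTop ℕ∞) f) : EvenTermsVanish f x (algE f x p) := by
  intro h i hi hi0 hw
  -- All arguments then lie in `F_m` and one lies in `F_{m+1}`, while the order is `2(m+1)`. This is
  -- where `p ≤ 4` matters: for `p = 5`, the exponents 2 on `E_3` and 6 on `E_5` have weight `14/15`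
  -- and order 8, so `m = 3`, yet `E_3` is only contained in `F_2`.
  obtain ⟨m, hm, hmp, hall, j₀, hj₀, hj₀m⟩ : ∃ m, ∑ j, i j = 2 * m + 1 + 1 ∧
      2 * m + 1 + 1 ≤ 2 * p ∧ (∀ j : Fin p, i j ≠ 0 → m ≤ j) ∧
      ∃ j : Fin p, i j ≠ 0 ∧ m + 1 ≤ (j : ℕ) := by
    choose hev _ using hi
    choose a ha using hev
    have hia : i = fun j => 2 * a j := by funext j; rw [ha j]; ring
    subst hia
    have hex : ∀ m, (¬ ∀ j : Fin p, 2 * a j ≠ 0 → (j : ℕ) ≤ m) →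
        ∃ j : Fin p, 2 * a j ≠ 0 ∧ m + 1 ≤ (j : ℕ) := fun m h => by
      push Not at h
      exact h
    have h0 : ¬ ∀ j, a j = 0 := fun h => hi0 (by funext j; simp [h j])
    -- Multiplying by 12, a common multiple of `1, 2, 3, 4`, turns the weight bound into an
    -- inequality over `ℕ` that `omega` can use.
    have hw' : ∑ j : Fin p, a j * (12 / ((j : ℕ) + 1)) < 12 := by
      have h12 : ((∑ j : Fin p, a j * (12 / ((j : ℕ) + 1)) : ℕ) : ℚ) =
          12 * weight (fun j => 2 * a j) := by
        rw [weight, Nat.cast_sum, Finset.mul_sum]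
        refine Finset.sum_congr rfl fun j _ => ?_
        have hdvd : (j : ℕ) + 1 ∣ 12 := by
          have := j.2
          obtain h | h | h | h : (j : ℕ) = 0 ∨ (j : ℕ) = 1 ∨ (j : ℕ) = 2 ∨ (j : ℕ) = 3 := by omega
          all_goals rw [h]; norm_num
        rw [Nat.cast_mul, Nat.cast_div hdvd (by positivity)]
        push_cast
        field_simp
      have : ((∑ j : Fin p, a j * (12 / ((j : ℕ) + 1)) : ℕ) : ℚ) < 12 := by
        rw [h12]; linarith
      exact_mod_cast this
    clear hw hi0 ha
    refine ⟨∑ j, a j - 1, ?_, ?_, ?_, hex _ ?_⟩ <;> clear hex <;> interval_cases p <;>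
      simp [Fin.sum_univ_succ, Fin.forall_fin_succ, ← mul_add] at hw' h0 ⊢ <;> omega
  rw [crossTerm_eq]
  obtain ⟨l₀, hl₀⟩ := exists_blockMap_eq hj₀
  have hmem : ∀ l, (algE f x p (blockMap i l)).starProjection h ∈ algF f x (blockMap i l) :=
    fun l => algE_le_algF f x p _ (Submodule.starProjection_apply_mem _ _)
  refine iteratedFDeriv_eq_zero_of_mem_algF (k := m) hm
    (hf.of_le (by rw [hm]; exact_mod_cast hmp)) _
    (fun l => algF_antitone f x (hall _ (blockMap_ne_zero i l)) (hmem l)) l₀ ?_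
  have := hmem l₀
  rw [hl₀] at this ⊢
  exact algF_antitone f x hj₀m this

/-! ### The counterexample: its derivatives and its algorithmic subspaces -/

/-- The polynomial `(X - Y²)² (X⁴ + Y⁶) + Y^{2p}`. -/
def curvePoly (p : ℕ) (X Y : ℝ) : ℝ :=
  (X - Y ^ 2) ^ 2 * (X ^ 4 + Y ^ 6) + Y ^ (2 * p)

/-- The polynomial `curvePoly` as a function on the plane. -/
def curveFun (p : ℕ) (h : RSpace 2) : ℝ := curvePoly p (h 0) (h 1)

/-- The monomial `X^m Y^{k-m}` as a multilinear map. -/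
def planeMonomial (k m : ℕ) : (RSpace 2) [×k]→L[ℝ] ℝ :=
  (ContinuousMultilinearMap.mkPiAlgebra ℝ (Fin k) ℝ).compContinuousLinearMap fun l =>
    EuclideanSpace.proj (if (l : ℕ) < m then 0 else 1)

theorem planeMonomial_apply (k m : ℕ) (v : Fin k → RSpace 2) :
    planeMonomial k m v = ∏ l : Fin k, v l (if (l : ℕ) < m then 0 else 1) := by
  simp [planeMonomial]

theorem planeMonomial_diagonal (m n : ℕ) (h : RSpace 2) :
    planeMonomial (m + n) m (fun _ => h) = h 0 ^ m * h 1 ^ n := by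
  rw [planeMonomial_apply, Fin.prod_univ_add]
  simp

/-- The Taylor series of `curveFun` at the origin. -/
def curveSeries (p : ℕ) : FormalMultilinearSeries ℝ (RSpace 2) ℝ := fun k =>
  (if k = 6 then planeMonomial k 6 else 0) + (if k = 7 then (-2 : ℝ) • planeMonomial k 5 else 0) +
  (if k = 8 then planeMonomial k 4 + planeMonomial k 2 else 0) +
  (if k = 9 then (-2 : ℝ) • planeMonomial k 1 else 0) +
  (if k = 10 then planeMonomial k 0 else 0) + (if k = 2 * p then planeMonomial k 0 else 0)

theorem curveSeries_diagonal (p k : ℕ) (h : RSpace 2) : curveSeries p k (fun _ => h) =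
    (if k = 6 then h 0 ^ 6 else 0) + (if k = 7 then -2 * (h 0 ^ 5 * h 1 ^ 2) else 0) +
    (if k = 8 then h 0 ^ 4 * h 1 ^ 4 + h 0 ^ 2 * h 1 ^ 6 else 0) +
    (if k = 9 then -2 * (h 0 * h 1 ^ 8) else 0) +
    (if k = 10 then h 1 ^ 10 else 0) + (if k = 2 * p then h 1 ^ (2 * p) else 0) := by
  have h1 : ∀ {c : Prop} [Decidable c] (T : (RSpace 2) [×k]→L[ℝ] ℝ) (v : Fin k → RSpace 2),
      (if c then T else 0) v = if c then T v else 0 := by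
    intro c _ T v; split_ifs <;> rfl
  simp only [curveSeries, add_apply, h1, smul_apply, smul_eq_mul]
  congr 1; congr 1; congr 1; congr 1; congr 1
  all_goals
    split_ifs with hk
    · subst hk
      first
      | (simp [planeMonomial_apply]; done)
      | rw [planeMonomial_diagonal 5 2 h]
      | rw [planeMonomial_diagonal 4 4 h, planeMonomial_diagonal 2 6 h]
      | simpa using planeMonomial_diagonal 1 8 h
    · rfl

theorem hasFPowerSeriesOnBall_curveFun {p : ℕ} (hp : 5 ≤ p) :
    HasFPowerSeriesOnBall (curveFun p) (curveSeries p) 0 ⊤ where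
  r_le := by
    rw [FormalMultilinearSeries.radius_eq_top_of_forall_image_add_eq_zero _ (2 * p + 1)]
    intro m
    simp only [curveSeries]
    repeat rw [if_neg (by omega)]
    simp
  r_pos := by simp
  hasSum := by
    intro h _
    rw [zero_add]
    have hs := hasSum_sum_of_ne_finset_zero (f := fun k => curveSeries p k fun _ => h)
      (s := Finset.range (2 * p + 1)) (L := SummationFilter.unconditional ℕ) (fun k hk => by
        rw [Finset.mem_range] at hk
        rw [curveSeries_diagonal]
        repeat rw [if_neg (by omega)]
        simp)
    have hval : ∑ k ∈ Finset.range (2 * p + 1), curveSeries p k (fun _ => h) = curveFun p h := by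
      simp only [curveSeries_diagonal, Finset.sum_add_distrib, Finset.sum_ite_eq',
        Finset.mem_range]
      repeat rw [if_pos (by omega)]
      simp only [curveFun, curvePoly]
      ring
    rw [hval] at hs
    exact hs

/-- The coefficients of `curveSeries` are not symmetric; the derivatives are their sums over
permutations. -/
theorem iteratedFDeriv_curveFun {p : ℕ} (hp : 5 ≤ p) {k : ℕ} (v : Fin k → RSpace 2) :
    iteratedFDeriv ℝ k (curveFun p) 0 v =
      ∑ σ : Equiv.Perm (Fin k), curveSeries p k (fun l => v (σ l)) :=
  (hasFPowerSeriesOnBall_curveFun hp).iteratedFDeriv_eq_sum_of_completeSpace v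

theorem taylorSum_curveFun {p : ℕ} (hp : 5 ≤ p) (q : ℕ) (h : RSpace 2) :
    ∑ k ∈ Finset.Icc 2 (2 * q),
      (1 / (k.factorial : ℝ)) * iteratedFDeriv ℝ k (curveFun p) 0 (fun _ => h) =
    ∑ k ∈ Finset.Icc 2 (2 * q), curveSeries p k (fun _ => h) := by
  refine Finset.sum_congr rfl fun k _ => ?_
  rw [iteratedFDeriv_curveFun hp, Finset.sum_const, Finset.card_univ, Fintype.card_perm,
    Fintype.card_fin, nsmul_eq_mul, ← mul_assoc, one_div, inv_mul_cancel₀ (by positivity), one_mul]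

theorem curvePoly_pos (p : ℕ) {X Y : ℝ} (h : X ≠ 0 ∨ Y ≠ 0) : 0 < curvePoly p X Y := by
  rw [curvePoly, pow_mul]
  by_cases hY : Y = 0
  · subst hY
    have hX : X ≠ 0 := h.resolve_right (by simp)
    have : 0 < (X ^ 3) ^ 2 := by positivity
    have h0 : 0 ≤ ((0 : ℝ) ^ 2) ^ p := by positivity
    nlinarith
  · positivity

theorem contDiff_curveFun (p : ℕ) (n : WithTop ℕ∞) : ContDiff ℝ n (curveFun p) := by
  unfold curveFun curvePoly
  fun_prop

theorem isStrictPolyLocalMin_curveFun {p : ℕ} (hp : 5 ≤ p) :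
    IsStrictPolyLocalMin p (curveFun p) 0 where
  contDiff := contDiff_curveFun p _
  isLocalMin := Eventually.of_forall fun h => by
    have h0 : curveFun p 0 = 0 := by
      simp [curveFun, curvePoly, show p ≠ 0 by omega]
    rw [h0, curveFun]
    by_cases hh : h 0 ≠ 0 ∨ h 1 ≠ 0
    · exact (curvePoly_pos p hh).le
    · push Not at hh
      simp [hh.1, hh.2, curvePoly, show p ≠ 0 by omega]
  isLeast := by
    refine ⟨⟨by omega, 1, one_pos, fun h _ hne => ?_⟩, fun q hq => ?_⟩
    · rw [taylorSum_curveFun hp]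
      simp only [curveSeries_diagonal, Finset.sum_add_distrib, Finset.sum_ite_eq', Finset.mem_Icc]
      repeat rw [if_pos (by omega)]
      have hor : h 0 ≠ 0 ∨ h 1 ≠ 0 := by
        by_contra hcon
        push Not at hcon
        apply hne
        ext l
        fin_cases l
        · exact hcon.1
        · exact hcon.2
      refine (curvePoly_pos p hor).trans_eq ?_
      rw [curvePoly]; ring
    · obtain ⟨-, r, hr, hpos⟩ := hq
      by_contra hlt
      push Not at hlt
      -- Curves on which the Taylor polynomial of order `2q`, `q < p`, vanishes: for `q ≤ 4` each of
      -- its monomials contains `X`, so the Y-axis serves; for `q ≥ 5` only `Y^{2p}` is missing, so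
      -- the parabola `X = Y²` serves.
      have hcurve : ∃ s : ℝ, 0 < s ∧ !₂[if 5 ≤ q then s ^ 2 else 0, s] ∈
          Metric.ball (0 : RSpace 2) r := by
        have hc : Continuous fun s : ℝ => (!₂[if 5 ≤ q then s ^ 2 else 0, s] : RSpace 2) := by
          refine (PiLp.continuous_toLp 2 _).comp (continuous_pi fun l => ?_)
          fin_cases l
          · simp only [Fin.zero_eta, Matrix.cons_val_zero]; split_ifs <;> fun_prop
          · simp only [Fin.mk_one, Matrix.cons_val_one]; fun_prop
        have h0 : (!₂[if 5 ≤ q then (0 : ℝ) ^ 2 else 0, 0] : RSpace 2) = 0 := by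
          ext l; fin_cases l <;> simp
        have ht := (hc.tendsto 0).mono_left (nhdsWithin_le_nhds (s := Set.Ioi 0))
        rw [h0] at ht
        obtain ⟨s, hs, hs0⟩ :=
          ((ht.eventually (Metric.ball_mem_nhds _ hr)).and self_mem_nhdsWithin).exists
        exact ⟨s, hs0, hs⟩
      obtain ⟨s, hs, hball⟩ := hcurve
      have hne : (!₂[if 5 ≤ q then s ^ 2 else 0, s] : RSpace 2) ≠ 0 := fun h => by
        have := congrArg (fun v : RSpace 2 => v 1) h
        simp at this
        exact hs.ne' this
      have h := hpos _ hball hne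
      rw [taylorSum_curveFun hp] at h
      refine h.ne' ?_
      simp only [curveSeries_diagonal, Finset.sum_add_distrib, Finset.sum_ite_eq', Finset.mem_Icc,
        Matrix.cons_val_zero, Matrix.cons_val_one]
      rw [if_neg (by omega : ¬ (2 ≤ 2 * p ∧ 2 * p ≤ 2 * q))]
      by_cases hq5 : 5 ≤ q
      · repeat rw [if_pos (by omega)]
        ring
      · rw [if_neg (by omega : ¬ (2 ≤ 10 ∧ 10 ≤ 2 * q))]
        simp [hq5]

theorem algF_curveFun_of_le_two {p : ℕ} (hp : 5 ≤ p) {k : ℕ} (hk : k ≤ 2) :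
    algF (curveFun p) 0 k = ⊤ := by
  induction k with
  | zero => rfl
  | succ k ih =>
    rw [eq_top_iff]
    intro h _
    refine ⟨by rw [ih (by omega)]; trivial, fun h' _ => ?_⟩
    rw [iteratedFDeriv_curveFun hp]
    refine Finset.sum_eq_zero fun σ _ => ?_
    simp only [curveSeries]
    repeat rw [if_neg (by omega)]
    simp

theorem iteratedFDeriv_six_curveFun {p : ℕ} (hp : 5 ≤ p) (h h' : RSpace 2) :
    iteratedFDeriv ℝ (2 * 2 + 1 + 1) (curveFun p) 0 (Fin.cons h fun _ => h') =
      720 * (h 0 * h' 0 ^ 5) := by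
  have h1 : ∀ v : Fin 6 → RSpace 2, curveSeries p 6 v = ∏ l, v l 0 := by
    intro v
    simp [curveSeries, planeMonomial_apply, show ¬ (6 = 2 * p) by omega]
  rw [iteratedFDeriv_curveFun hp]
  have h2 : ∀ σ : Equiv.Perm (Fin 6),
      curveSeries p 6 (fun l => (Fin.cons h (fun _ => h') : Fin 6 → RSpace 2) (σ l)) =
        h 0 * h' 0 ^ 5 := by
    intro σ
    rw [h1, Equiv.prod_comp σ (fun l => (Fin.cons h (fun _ => h') : Fin 6 → RSpace 2) l 0),
      Fin.prod_univ_succ]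
    simp
  refine (Finset.sum_congr rfl fun σ _ => h2 σ).trans ?_
  rw [Finset.sum_const, Finset.card_univ, Fintype.card_perm, Fintype.card_fin, nsmul_eq_mul]
  norm_num [Nat.factorial]

theorem mem_algF_three_curveFun {p : ℕ} (hp : 5 ≤ p) {h : RSpace 2} :
    h ∈ algF (curveFun p) 0 3 ↔ h 0 = 0 := by
  constructor
  · intro hh
    have := hh.2 (EuclideanSpace.single 0 1) (by rw [algF_curveFun_of_le_two hp le_rfl]; trivial)
    rw [iteratedFDeriv_six_curveFun hp] at this
    simpa using this
  · intro hh
    refine ⟨by rw [algF_curveFun_of_le_two hp le_rfl]; trivial, fun h' _ => ?_⟩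
    rw [iteratedFDeriv_six_curveFun hp, hh]
    ring

/-- Both monomials of degree 8 contain `X`, so order 8 does not see the Y-axis; it is first detected
by `Y^10`. -/
theorem mem_algF_four_curveFun {p : ℕ} (hp : 5 ≤ p) {h : RSpace 2} (hh : h 0 = 0) :
    h ∈ algF (curveFun p) 0 4 := by
  refine ⟨(mem_algF_three_curveFun hp).2 hh, fun h' hh' => ?_⟩
  rw [mem_algF_three_curveFun hp] at hh'
  rw [iteratedFDeriv_curveFun hp]
  refine Finset.sum_eq_zero fun σ _ => ?_
  have h1 : ∀ l, (Fin.cons h (fun _ => h') : Fin (2 * 3 + 1 + 1) → RSpace 2) l 0 = 0 := by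
    intro l
    refine Fin.cases ?_ (fun m => ?_) l
    · simpa using hh
    · simpa using hh'
  have h2 : ∀ m, 0 < m → planeMonomial (2 * 3 + 1 + 1) m
      (fun l => (Fin.cons h (fun _ => h') : Fin (2 * 3 + 1 + 1) → RSpace 2) (σ l)) = 0 := by
    intro m hm
    rw [planeMonomial_apply]
    refine Finset.prod_eq_zero (Finset.mem_univ 0) ?_
    rw [if_pos (by simpa using hm)]
    exact h1 _
  have h3 : ∀ v : Fin 8 → RSpace 2,
      curveSeries p 8 v = planeMonomial 8 4 v + planeMonomial 8 2 v := by
    intro v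
    simp [curveSeries, show ¬ (8 = 2 * p) by omega]
  exact (h3 _).trans
    ((congrArg₂ (· + ·) (h2 4 (by norm_num)) (h2 2 (by norm_num))).trans (add_zero 0))

theorem algF_five_curveFun {p : ℕ} (hp : 5 < p) : algF (curveFun p) 0 5 = ⊥ := by
  rw [eq_bot_iff]
  intro h hh
  have h0 : h 0 = 0 := (mem_algF_three_curveFun hp.le).1 (algF_antitone _ _ (by norm_num) hh)
  have h1 : ∀ v : Fin 10 → RSpace 2, curveSeries p 10 v = ∏ l, v l 1 := by
    intro v
    simp [curveSeries, planeMonomial_apply, show ¬ (10 = 2 * p) by omega]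
  have h2 := hh.2 (EuclideanSpace.single 1 1) (mem_algF_four_curveFun hp.le (by simp))
  rw [iteratedFDeriv_curveFun hp.le] at h2
  have h3 : ∀ σ : Equiv.Perm (Fin 10), curveSeries p 10
      (fun l => (Fin.cons h (fun _ => EuclideanSpace.single 1 1) : Fin 10 → RSpace 2) (σ l)) =
        h 1 := by
    intro σ
    rw [h1, Equiv.prod_comp σ
      (fun l => (Fin.cons h (fun _ => EuclideanSpace.single 1 1) : Fin 10 → RSpace 2) l 1),
      Fin.prod_univ_succ]
    simp
  have h4 := (Finset.sum_congr rfl fun σ _ => h3 σ).symm.trans h2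
  rw [Finset.sum_const, Finset.card_univ, Fintype.card_perm, Fintype.card_fin, nsmul_eq_mul] at h4
  have h5 : h 1 = 0 := (mul_eq_zero.1 h4).resolve_left (by positivity)
  rw [Submodule.mem_bot]
  ext l
  fin_cases l
  · exact h0
  · exact h5

theorem single_zero_mem_algE_curveFun {p : ℕ} (hp : 5 ≤ p) :
    EuclideanSpace.single 0 1 ∈ algE (curveFun p) 0 p ⟨2, by omega⟩ := by
  rw [algE, if_pos (by simp; omega)]
  refine ⟨by rw [algF_curveFun_of_le_two hp le_rfl]; trivial, ?_⟩
  intro h hh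
  rw [EuclideanSpace.inner_single_right, (mem_algF_three_curveFun hp).1 hh]
  simp

theorem single_one_mem_algE_curveFun {p : ℕ} (hp : 5 ≤ p) :
    EuclideanSpace.single 1 1 ∈ algE (curveFun p) 0 p ⟨4, by omega⟩ := by
  have h4 : EuclideanSpace.single 1 1 ∈ algF (curveFun p) 0 4 :=
    mem_algF_four_curveFun hp (by simp)
  rw [algE]
  split_ifs with h
  · refine ⟨h4, ?_⟩
    change _ ∈ (algF (curveFun p) 0 5)ᗮ
    rw [algF_five_curveFun h, Submodule.bot_orthogonal_eq_top]
    trivial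
  · exact h4

/-! ### Blow-up and obstruction by weighted scalings -/

theorem tendsto_rpow_nhdsGT_zero {e : ℝ} (he : 0 ≤ e) :
    Tendsto (fun t : ℝ => t ^ e) (𝓝[>] 0) (𝓝 ((0 : ℝ) ^ e)) :=
  (Real.continuousAt_rpow_const 0 e (Or.inr he)).tendsto.mono_left nhdsWithin_le_nhds

theorem tendsto_root_nhdsGT_zero {N : ℕ} (hN : N ≠ 0) :
    Tendsto (fun t : ℝ => t ^ (1 / (N : ℝ))) (𝓝[>] 0) (𝓝[>] 0) := by
  have hpos : (0 : ℝ) < 1 / N := by positivity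
  refine tendsto_nhdsWithin_iff.2 ⟨?_, ?_⟩
  · have := tendsto_rpow_nhdsGT_zero hpos.le
    rwa [Real.zero_rpow hpos.ne'] at this
  · filter_upwards [self_mem_nhdsWithin] with t ht
    exact Real.rpow_pos_of_pos ht _

theorem root_pow {t : ℝ} (ht : 0 < t) {N : ℕ} (hN : N ≠ 0) : (t ^ (1 / (N : ℝ))) ^ N = t := by
  rw [one_div]; exact Real.rpow_inv_natCast_pow ht.le hN

theorem rpow_eq_root_pow_mul {t : ℝ} (ht : 0 < t) (a : ℝ) (m N : ℕ) :
    t ^ a = (t ^ (1 / (N : ℝ))) ^ m * t ^ (a - m / N) := by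
  rw [← Real.rpow_natCast, ← Real.rpow_mul ht.le, ← Real.rpow_add ht]
  congr 1; ring

theorem rescaled_curveFun {p : ℕ} (hp : p ≠ 0) (E : Fin p → Submodule ℝ (RSpace 2)) (t : ℝ)
    (h : RSpace 2) : rescaled (curveFun p) 0 E t h =
      (1 / t) * curvePoly p (dilation E t h 0) (dilation E t h 1) := by
  have h0 : curveFun p 0 = 0 := by simp [curveFun, curvePoly, hp]
  rw [rescaled, h0, sub_zero, zero_add]
  rfl

theorem IsOrthDecomp.dilation_pair {d p : ℕ} {E : Fin p → Submodule ℝ (RSpace d)}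
    (hE : IsOrthDecomp E) {j l : Fin p} {u v : RSpace d} (hu : u ∈ E j) (hv : v ∈ E l)
    (t α β : ℝ) (i : Fin d) : dilation E t (α • u + β • v) i =
      t ^ (1 / (2 * ((j : ℝ) + 1))) * (α * u i) + t ^ (1 / (2 * ((l : ℝ) + 1))) * (β * v i) := by
  rw [dilation_add, dilation_smul, dilation_smul, hE.dilation_of_mem hu, hE.dilation_of_mem hv]
  simp only [PiLp.add_apply, PiLp.smul_apply, smul_eq_mul]
  ring

/-- If `curvePoly` is homogeneous up to a continuous factor `Φ` under a weighted scaling, the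
rescaled increments behave accordingly. -/
theorem tendsto_mul_rescaled_curveFun {p : ℕ} (hp : p ≠ 0) (E : Fin p → Submodule ℝ (RSpace 2))
    (h : RSpace 2) (N m n e : ℕ) (hN : N ≠ 0) (Φ : ℝ × ℝ × ℝ → ℝ) (hΦ : Continuous Φ)
    (hscale : ∀ s x y, s ^ e * curvePoly p (s ^ m * x) (s ^ n * y) = s ^ N * Φ (s, x, y))
    {x y : ℝ → ℝ} {x₀ y₀ : ℝ} (hx : Tendsto x (𝓝[>] 0) (𝓝 x₀)) (hy : Tendsto y (𝓝[>] 0) (𝓝 y₀))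
    (h0 : ∀ t > 0, dilation E t h 0 = (t ^ (1 / (N : ℝ))) ^ m * x t)
    (h1 : ∀ t > 0, dilation E t h 1 = (t ^ (1 / (N : ℝ))) ^ n * y t) :
    Tendsto (fun t => (t ^ (1 / (N : ℝ))) ^ e * rescaled (curveFun p) 0 E t h) (𝓝[>] 0)
      (𝓝 (Φ (0, x₀, y₀))) := by
  have hs := (tendsto_root_nhdsGT_zero hN).mono_right nhdsWithin_le_nhds
  have hlim := (hΦ.tendsto (0, x₀, y₀)).comp (hs.prodMk_nhds (hx.prodMk_nhds hy))
  refine hlim.congr' ?_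
  filter_upwards [self_mem_nhdsWithin] with t ht
  have ht : 0 < t := ht
  rw [rescaled_curveFun hp, h0 t ht, h1 t ht, Function.comp_apply]
  have := hscale (t ^ (1 / (N : ℝ))) (x t) (y t)
  rw [root_pow ht hN] at this
  rw [mul_left_comm, this, ← mul_assoc, one_div_mul_cancel ht.ne', one_mul]

theorem eq_zero_of_tendsto_root_pow_mul {g : ℝ → ℝ} {a b : ℝ} {N e : ℕ} (hN : N ≠ 0) (he : e ≠ 0)
    (hg : Tendsto g (𝓝[>] 0) (𝓝 a))
    (hb : Tendsto (fun t => (t ^ (1 / (N : ℝ))) ^ e * g t) (𝓝[>] 0) (𝓝 b)) : b = 0 := by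
  have hs := ((tendsto_root_nhdsGT_zero hN).mono_right nhdsWithin_le_nhds).pow e
  have := tendsto_nhds_unique hb (hs.mul hg)
  simpa [he] using this

/-- The isotropic scaling factor of `curvePoly (q + 5)` of degree `6`. -/
def isoFactor (q : ℕ) (a : ℝ × ℝ × ℝ) : ℝ :=
  (a.2.1 - a.1 * a.2.2 ^ 2) ^ 2 * (a.2.1 ^ 4 + a.1 ^ 2 * a.2.2 ^ 6) +
    a.1 ^ (2 * q + 4) * a.2.2 ^ (2 * (q + 5))

theorem continuous_isoFactor (q : ℕ) : Continuous (isoFactor q) := by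
  unfold isoFactor; fun_prop

theorem isoFactor_scale (q e : ℕ) (s x y : ℝ) :
    s ^ e * curvePoly (q + 5) (s ^ 1 * x) (s ^ 1 * y) = s ^ (6 + e) * isoFactor q (s, x, y) := by
  simp only [curvePoly, isoFactor]; ring

/-- A vector with nonzero first coordinate lies in one of the first three subspaces. -/
theorem index_le_two {q : ℕ} {E : Fin (q + 5) → Submodule ℝ (RSpace 2)} (hE : IsOrthDecomp E)
    (hA : ConvergesOnCompacts (curveFun (q + 5)) 0 E) {j : Fin (q + 5)} {w : RSpace 2}
    (hw : w ∈ E j) (hw0 : w 0 ≠ 0) : (j : ℕ) ≤ 2 := by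
  by_contra hj
  obtain ⟨r, hr⟩ : ∃ r, (j : ℕ) = r + 3 := ⟨j - 3, by omega⟩
  have hN : 1 / (2 * ((j : ℝ) + 1)) = 1 / ((6 + (2 * r + 2) : ℕ) : ℝ) := by
    rw [hr]; push_cast; ring
  have hT := tendsto_mul_rescaled_curveFun (p := q + 5) (by omega) E w (6 + (2 * r + 2)) 1 1
    (2 * r + 2) (by omega) (isoFactor q) (continuous_isoFactor q) (isoFactor_scale q (2 * r + 2))
    (tendsto_const_nhds (x := w 0)) (tendsto_const_nhds (x := w 1))
    (fun t _ => by rw [hE.dilation_of_mem hw, hN]; simp)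
    (fun t _ => by rw [hE.dilation_of_mem hw, hN]; simp)
  have := eq_zero_of_tendsto_root_pow_mul (by omega) (by omega) (hA.tendsto w) hT
  -- If the block came after `E_3`, the term `X^6` would be of order larger than `t`; convergence
  -- would force `w 0 ^ 6 = 0`.
  simp [isoFactor, hw0] at this

/-- A nonzero vector with zero first coordinate lies in one of the first five subspaces. -/
theorem index_le_four {q : ℕ} {E : Fin (q + 5) → Submodule ℝ (RSpace 2)} (hE : IsOrthDecomp E)
    (hA : ConvergesOnCompacts (curveFun (q + 5)) 0 E) {j : Fin (q + 5)} {w : RSpace 2}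
    (hw : w ∈ E j) (hw0 : w 0 = 0) (hw1 : w 1 ≠ 0) : (j : ℕ) ≤ 4 := by
  by_contra hj
  obtain ⟨r, hr⟩ : ∃ r, (j : ℕ) = r + 5 := ⟨j - 5, by omega⟩
  have hN : 1 / (2 * ((j : ℝ) + 1)) = 1 / ((10 + (2 * r + 2) : ℕ) : ℝ) := by
    rw [hr]; push_cast; ring
  -- With weights `(2, 1)` the factor `X - Y²` is homogeneous and the lowest degree is 10. On the
  -- Y-axis the limit is `Y^10`, plus another `Y^10` when `p = 5`.
  have hT := tendsto_mul_rescaled_curveFun (p := q + 5) (by omega) E w (10 + (2 * r + 2)) 2 1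
    (2 * r + 2) (by omega)
    (fun a => (a.2.1 - a.2.2 ^ 2) ^ 2 * (a.1 ^ 2 * a.2.1 ^ 4 + a.2.2 ^ 6) +
      a.1 ^ (2 * q) * a.2.2 ^ (2 * (q + 5))) (by fun_prop)
    (fun s x y => by simp only [curvePoly]; ring)
    (tendsto_const_nhds (x := 0)) (tendsto_const_nhds (x := w 1))
    (fun t _ => by rw [hE.dilation_of_mem hw, hN]; simp [hw0])
    (fun t _ => by rw [hE.dilation_of_mem hw, hN]; simp)
  have := eq_zero_of_tendsto_root_pow_mul (by omega) (by omega) (hA.tendsto w) hT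
  have h10 : 0 < (w 1 ^ 5) ^ 2 := by positivity
  have hrest : 0 ≤ (0 : ℝ) ^ (2 * q) * w 1 ^ (2 * (q + 5)) := by
    rw [pow_mul, pow_mul]; positivity
  simp only at this
  nlinarith

/-- With `s = t^{1/30}` the axes scale as `s^5` and `s^3`. The lowest term `X²Y⁶` has degree 28
while `t = s^30`, hence the compensating factor `s²`. -/
theorem tendsto_rescaled_third_fifth {q : ℕ} {E : Fin (q + 5) → Submodule ℝ (RSpace 2)}
    (hE : IsOrthDecomp E) {j l : Fin (q + 5)} (hj : (j : ℕ) = 2) (hl : (l : ℕ) = 4)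
    {u v : RSpace 2} (hu : u ∈ E j) (hv : v ∈ E l) (hu1 : u 1 = 0) (hv0 : v 0 = 0) :
    Tendsto (fun t => (t ^ (1 / ((30 : ℕ) : ℝ))) ^ 2 * rescaled (curveFun (q + 5)) 0 E t (u + v))
      (𝓝[>] 0) (𝓝 (u 0 ^ 2 * v 1 ^ 6)) := by
  have huv : u + v = (1 : ℝ) • u + (1 : ℝ) • v := by simp
  have hT := tendsto_mul_rescaled_curveFun (p := q + 5) (by omega) E (u + v) 30 5 3 2 (by omega)
    (fun a => (a.2.1 - a.1 * a.2.2 ^ 2) ^ 2 * (a.1 ^ 2 * a.2.1 ^ 4 + a.2.2 ^ 6) +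
      a.1 ^ (6 * q + 2) * a.2.2 ^ (2 * (q + 5))) (by fun_prop)
    (fun s x y => by simp only [curvePoly]; ring)
    (tendsto_const_nhds (x := u 0)) (tendsto_const_nhds (x := v 1))
    (fun t ht => by
      rw [huv, hE.dilation_pair hu hv, hv0, rpow_eq_root_pow_mul ht _ 5 30, hj]
      norm_num)
    (fun t ht => by
      rw [huv, hE.dilation_pair hu hv, hu1, rpow_eq_root_pow_mul ht (1 / (2 * ((l : ℝ) + 1))) 3 30,
        hl]
      norm_num)
  convert hT using 2
  simp

/-- When both scales are at most `t^{1/6}`, only `X^6` survives. The factor `0 ^ (1/(2(j+1)) - 1/6)`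
is a switch: `0 ^ 0 = 1` for `E_3`, and `0` for the earlier blocks. -/
theorem limitPoly_of_index_le_two {q : ℕ} {E : Fin (q + 5) → Submodule ℝ (RSpace 2)}
    (hE : IsOrthDecomp E) (hA : ConvergesOnCompacts (curveFun (q + 5)) 0 E) {j l : Fin (q + 5)}
    (hj : (j : ℕ) ≤ 2) (hl : (l : ℕ) ≤ 2) {u v : RSpace 2} (hu : u ∈ E j) (hv : v ∈ E l)
    (α β : ℝ) : limitPoly (curveFun (q + 5)) 0 E (α • u + β • v) =
      ((0 : ℝ) ^ (1 / (2 * ((j : ℝ) + 1)) - 1 / 6) * (α * u 0) +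
        (0 : ℝ) ^ (1 / (2 * ((l : ℝ) + 1)) - 1 / 6) * (β * v 0)) ^ 6 := by
  have hexp : ∀ {k : Fin (q + 5)}, (k : ℕ) ≤ 2 → 0 ≤ 1 / (2 * ((k : ℝ) + 1)) - 1 / 6 := by
    intro k hk
    rw [sub_nonneg]
    have : ((k : ℕ) : ℝ) ≤ 2 := by exact_mod_cast hk
    exact one_div_le_one_div_of_le (by positivity) (by linarith)
  have hlim : ∀ i, Tendsto (fun t : ℝ => t ^ (1 / (2 * ((j : ℝ) + 1)) - 1 / 6) * (α * u i) +
      t ^ (1 / (2 * ((l : ℝ) + 1)) - 1 / 6) * (β * v i)) (𝓝[>] 0)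
      (𝓝 ((0 : ℝ) ^ (1 / (2 * ((j : ℝ) + 1)) - 1 / 6) * (α * u i) +
        (0 : ℝ) ^ (1 / (2 * ((l : ℝ) + 1)) - 1 / 6) * (β * v i))) := fun i =>
    ((tendsto_rpow_nhdsGT_zero (hexp hj)).mul_const _).add
      ((tendsto_rpow_nhdsGT_zero (hexp hl)).mul_const _)
  have hdil : ∀ i, ∀ t > 0, dilation E t (α • u + β • v) i = (t ^ (1 / ((6 + 0 : ℕ) : ℝ))) ^ 1 *
      (t ^ (1 / (2 * ((j : ℝ) + 1)) - 1 / 6) * (α * u i) +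
        t ^ (1 / (2 * ((l : ℝ) + 1)) - 1 / 6) * (β * v i)) := by
    intro i t ht
    rw [hE.dilation_pair hu hv, rpow_eq_root_pow_mul ht (1 / (2 * ((j : ℝ) + 1))) 1 6,
      rpow_eq_root_pow_mul ht (1 / (2 * ((l : ℝ) + 1))) 1 6]
    push_cast
    ring
  have hT := tendsto_mul_rescaled_curveFun (p := q + 5) (by omega) E (α • u + β • v) (6 + 0) 1 1 0
    (by omega) (isoFactor q) (continuous_isoFactor q) (isoFactor_scale q 0) (hlim 0) (hlim 1)
    (hdil 0) (hdil 1)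
  simp only [pow_zero, one_mul] at hT
  rw [tendsto_nhds_unique (hA.tendsto _) hT, isoFactor]
  simp only [zero_mul, sub_zero, ne_eq, OfNat.ofNat_ne_zero, not_false_eq_true, zero_pow, add_zero,
    Nat.add_eq_zero_iff, and_false]
  ring

theorem zero_rpow_exponent {q : ℕ} {j : Fin (q + 5)} {k : ℕ} (hj : (j : ℕ) < k) :
    (0 : ℝ) ^ (1 / (2 * ((j : ℝ) + 1)) - 1 / (2 * ((k : ℝ) + 1))) = 0 := by
  refine Real.zero_rpow (sub_pos.2 ?_).ne'
  have : ((j : ℕ) : ℝ) < k := by exact_mod_cast hj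
  exact one_div_lt_one_div_of_lt (by positivity) (by linarith)

theorem limitPoly_of_axes {q : ℕ} {E : Fin (q + 5) → Submodule ℝ (RSpace 2)}
    (hE : IsOrthDecomp E) (hA : ConvergesOnCompacts (curveFun (q + 5)) 0 E) {j l : Fin (q + 5)}
    {u v : RSpace 2} (hu : u ∈ E j) (hv : v ∈ E l) (hu1 : u 1 = 0) (hv0 : v 0 = 0)
    (N m n : ℕ) (hN : N ≠ 0) (Φ : ℝ × ℝ × ℝ → ℝ) (hΦ : Continuous Φ)
    (hscale : ∀ s x y, curvePoly (q + 5) (s ^ m * x) (s ^ n * y) = s ^ N * Φ (s, x, y))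
    (hm : 0 ≤ 1 / (2 * ((j : ℝ) + 1)) - m / N) (hn : 0 ≤ 1 / (2 * ((l : ℝ) + 1)) - n / N)
    (α β : ℝ) : limitPoly (curveFun (q + 5)) 0 E (α • u + β • v) =
      Φ (0, (0 : ℝ) ^ (1 / (2 * ((j : ℝ) + 1)) - m / N) * (α * u 0),
        (0 : ℝ) ^ (1 / (2 * ((l : ℝ) + 1)) - n / N) * (β * v 1)) := by
  have hT := tendsto_mul_rescaled_curveFun (p := q + 5) (by omega) E (α • u + β • v) N m n 0
    hN Φ hΦ (by simpa using hscale) ((tendsto_rpow_nhdsGT_zero hm).mul_const (α * u 0))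
    ((tendsto_rpow_nhdsGT_zero hn).mul_const (β * v 1))
    (fun t ht => by
      rw [hE.dilation_pair hu hv, hv0, rpow_eq_root_pow_mul ht (1 / (2 * ((j : ℝ) + 1))) m N]
      ring)
    (fun t ht => by
      rw [hE.dilation_pair hu hv, hu1, rpow_eq_root_pow_mul ht (1 / (2 * ((l : ℝ) + 1))) n N]
      ring)
  simp only [pow_zero, one_mul] at hT
  exact tendsto_nhds_unique (hA.tendsto _) hT

/-- The limit polynomial does not depend on one of the two directions `u`, `v`. -/
def IndepOfOne {d p : ℕ} (f : RSpace d → ℝ) (x : RSpace d)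
    (E : Fin p → Submodule ℝ (RSpace d)) (u v : RSpace d) : Prop :=
  (∀ α α' β : ℝ, limitPoly f x E (α • u + β • v) = limitPoly f x E (α' • u + β • v)) ∨
    ∀ α β β' : ℝ, limitPoly f x E (α • u + β • v) = limitPoly f x E (α • u + β' • v)

theorem IndepOfOne.symm {d p : ℕ} {f : RSpace d → ℝ} {x : RSpace d}
    {E : Fin p → Submodule ℝ (RSpace d)} {u v : RSpace d} (h : IndepOfOne f x E u v) :
    IndepOfOne f x E v u := by
  rcases h with h | h
  · refine Or.inr fun α β β' => ?_
    rw [add_comm, h β β' α, add_comm]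
  · refine Or.inl fun α α' β => ?_
    rw [add_comm, h β α α', add_comm]

theorem indepOfOne_of_index_le_two {q : ℕ} {E : Fin (q + 5) → Submodule ℝ (RSpace 2)}
    (hE : IsOrthDecomp E) (hA : ConvergesOnCompacts (curveFun (q + 5)) 0 E) {j l : Fin (q + 5)}
    (hjl : j ≠ l) (hj : (j : ℕ) ≤ 2) (hl : (l : ℕ) ≤ 2) {u v : RSpace 2} (hu : u ∈ E j)
    (hv : v ∈ E l) : IndepOfOne (curveFun (q + 5)) 0 E u v := by
  have h6 : (1 : ℝ) / 6 = 1 / (2 * (((2 : ℕ) : ℝ) + 1)) := by norm_num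
  have hne : (j : ℕ) ≠ l := fun h => hjl (Fin.ext h)
  rcases lt_or_ge (j : ℕ) 2 with h2 | h2
  · refine Or.inl fun α α' β => ?_
    rw [limitPoly_of_index_le_two hE hA hj hl hu hv, limitPoly_of_index_le_two hE hA hj hl hu hv,
      h6, zero_rpow_exponent h2]
    ring
  · refine Or.inr fun α β β' => ?_
    rw [limitPoly_of_index_le_two hE hA hj hl hu hv, limitPoly_of_index_le_two hE hA hj hl hu hv,
      h6, zero_rpow_exponent (j := l) (by omega)]
    ring

/-- Convergence puts the X-axis in `E_3` or earlier and the Y-axis in `E_5` or earlier, and the pair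
`E_3`, `E_5` blows up. Otherwise `X` disappears (X-axis before `E_3`) or `Y` does (Y-axis before
`E_5`). -/
theorem indepOfOne_of_axes {q : ℕ} {E : Fin (q + 5) → Submodule ℝ (RSpace 2)}
    (hE : IsOrthDecomp E) (hA : ConvergesOnCompacts (curveFun (q + 5)) 0 E) {j l : Fin (q + 5)}
    {u v : RSpace 2} (hu : u ∈ E j) (hv : v ∈ E l) (hu1 : u 1 = 0) (hv0 : v 0 = 0)
    (hu0 : u 0 ≠ 0) (hv1 : v 1 ≠ 0) : IndepOfOne (curveFun (q + 5)) 0 E u v := by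
  have hj := index_le_two hE hA hu hu0
  have hl := index_le_four hE hA hv hv0 hv1
  have hexp : ∀ {k : Fin (q + 5)} {m : ℕ}, (k : ℕ) ≤ m →
      0 ≤ 1 / (2 * ((k : ℝ) + 1)) - 1 / (2 * ((m : ℝ) + 1)) := by
    intro k m hk
    rw [sub_nonneg]
    have : ((k : ℕ) : ℝ) ≤ m := by exact_mod_cast hk
    exact one_div_le_one_div_of_le (by positivity) (by linarith)
  rcases lt_or_ge (j : ℕ) 2 with h2 | h2
  · refine Or.inl fun α α' β => ?_
    -- The extreme remaining case has scales `t^{1/4} = s^5` and `t^{1/10} = s^2`, with `s =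
    -- t^{1/20}`: only pure powers of `Y` survive.
    have key := limitPoly_of_axes hE hA hu hv hu1 hv0 20 5 2 (by norm_num)
      (fun a => (a.1 * a.2.1 - a.2.2 ^ 2) ^ 2 * (a.1 ^ 8 * a.2.1 ^ 4 + a.2.2 ^ 6) +
        a.1 ^ (4 * q) * a.2.2 ^ (2 * (q + 5))) (by fun_prop)
      (fun s x y => by simp only [curvePoly]; ring)
      (by have := hexp (show (j : ℕ) ≤ 1 by omega); norm_num at this ⊢; linarith)
      (by have := hexp hl; norm_num at this ⊢; linarith)
    rw [key, key]
    simp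
  · have hj2 : (j : ℕ) = 2 := by omega
    rcases hl.eq_or_lt with h4 | h4
    · have hT := tendsto_rescaled_third_fifth hE hj2 h4 hu hv hu1 hv0
      have := eq_zero_of_tendsto_root_pow_mul (by norm_num) (by norm_num) (hA.tendsto _) hT
      simp [hu0, hv1] at this
    · refine Or.inr fun α β β' => ?_
      -- The extreme case has scales `t^{1/6} = s^4` and `t^{1/8} = s^3`, with `s = t^{1/24}`: only
      -- `X^6` survives.
      have key := limitPoly_of_axes hE hA hu hv hu1 hv0 24 4 3 (by norm_num)
        (fun a => (a.2.1 - a.1 ^ 2 * a.2.2 ^ 2) ^ 2 * (a.2.1 ^ 4 + a.1 ^ 2 * a.2.2 ^ 6) +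
          a.1 ^ (6 * q + 6) * a.2.2 ^ (2 * (q + 5))) (by fun_prop)
        (fun s x y => by simp only [curvePoly]; ring)
        (by have := hexp hj; norm_num at this ⊢; linarith)
        (by have := hexp (show (l : ℕ) ≤ 3 by omega); norm_num at this ⊢; linarith)
      rw [key, key]
      simp

theorem map_eq_add_smul (B : RSpace 2 ≃ₗᵢ[ℝ] RSpace 2) (h : RSpace 2) :
    B h = h 0 • B (EuclideanSpace.single 0 1) + h 1 • B (EuclideanSpace.single 1 1) := by
  conv_lhs => rw [euclideanSpace_eq_sum_single h, Fin.sum_univ_two]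
  rw [map_add, map_smul, map_smul]

theorem IndepOfOne.not_nonconstant {p : ℕ} {f : RSpace 2 → ℝ} {x : RSpace 2}
    {E : Fin p → Submodule ℝ (RSpace 2)} {B : RSpace 2 ≃ₗᵢ[ℝ] RSpace 2}
    (h : IndepOfOne f x E (B (EuclideanSpace.single 0 1)) (B (EuclideanSpace.single 1 1))) :
    ¬ NonconstantInEachVariable (fun h => limitPoly f x E (B h)) := by
  intro hC
  rcases h with h | h
  · obtain ⟨a, b, hab, hne⟩ := hC 0
    apply hne
    dsimp only
    rw [map_eq_add_smul B a, map_eq_add_smul B b, hab 1 (by norm_num)]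
    exact h _ _ _
  · obtain ⟨a, b, hab, hne⟩ := hC 1
    apply hne
    dsimp only
    rw [map_eq_add_smul B a, map_eq_add_smul B b, hab 0 (by norm_num)]
    exact h _ _ _

/-- In one adapted basis `u`, `v`, three cases arise: a single block, two blocks along the
coordinate axes, or two oblique blocks. In the oblique case both vectors have a nonzero X-component,
so both blocks are among the first three and the earlier one disappears. -/
theorem not_exists_decomp_curveFun (q : ℕ) :
    ¬ ∃ E : Fin (q + 5) → Submodule ℝ (RSpace 2), IsOrthDecomp E ∧
      EvenTermsVanish (curveFun (q + 5)) 0 E ∧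
      ∀ B : RSpace 2 ≃ₗᵢ[ℝ] RSpace 2, IsAdapted E B →
        NonconstantInEachVariable (fun h => limitPoly (curveFun (q + 5)) 0 E (B h)) := by
  rintro ⟨E, hE, hV, hC⟩
  have hmin := isStrictPolyLocalMin_curveFun (p := q + 5) (by omega)
  have hA := convergesOnCompacts_of_evenTermsVanish (by omega) hmin.contDiff hmin.isLocalMin hE hV
  obtain ⟨B, hB⟩ := hE.exists_isAdapted
  obtain ⟨j, hj⟩ := hE.exists_inBlock 0
  obtain ⟨l, hl⟩ := hE.exists_inBlock 1
  have hu := hB 0 j hj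
  have hv := hB 1 l hl
  by_cases hjl : j = l
  · subst hjl
    have htop : ∀ w, w ∈ E j := by
      intro w
      rw [← B.apply_symm_apply w, map_eq_add_smul]
      exact add_mem (Submodule.smul_mem _ _ hu) (Submodule.smul_mem _ _ hv)
    have hj2 : (j : ℕ) ≤ 2 :=
      index_le_two hE hA (htop (EuclideanSpace.single 0 1)) (by simp)
    -- A single block is the whole plane, so every isometry is adapted. (C) is refuted at the
    -- identity, where the limit depends on `X` alone; a rotated basis could mix the variables.
    have hid : IsAdapted E (LinearIsometryEquiv.refl ℝ (RSpace 2)) := by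
      intro i j' hj'
      have : j' = j := by
        fin_cases i
        · exact inBlock_unique hj' hj
        · exact inBlock_unique hj' hl
      rw [this]
      exact htop _
    refine IndepOfOne.not_nonconstant (B := LinearIsometryEquiv.refl ℝ (RSpace 2)) (Or.inr ?_)
      (hC _ hid)
    intro α β β'
    rw [limitPoly_of_index_le_two hE hA hj2 hj2 (htop _) (htop _),
      limitPoly_of_index_le_two hE hA hj2 hj2 (htop _) (htop _)]
    simp
  · refine IndepOfOne.not_nonconstant (B := B) ?_ (hC B hB)
    set u := B (EuclideanSpace.single 0 1) with hu'
    set v := B (EuclideanSpace.single 1 1) with hv'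
    have horth : u 0 * v 0 + u 1 * v 1 = 0 := by
      have h1 : inner ℝ u v = 0 := by
        rw [hu', hv', LinearIsometryEquiv.inner_map_map, EuclideanSpace.inner_single_right]
        simp
      rw [PiLp.inner_apply, Fin.sum_univ_two] at h1
      simp at h1
      linarith
    have hne : ∀ i, B (EuclideanSpace.single i 1) 0 ≠ 0 ∨ B (EuclideanSpace.single i 1) 1 ≠ 0 := by
      intro i
      by_contra hcon
      push Not at hcon
      have h0 : B (EuclideanSpace.single i (1 : ℝ)) = 0 := by
        ext k
        fin_cases k
        · exact hcon.1
        · exact hcon.2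
      rw [LinearIsometryEquiv.map_eq_zero_iff] at h0
      simp at h0
    have hune := hne 0
    have hvne := hne 1
    rw [← hu'] at hune
    rw [← hv'] at hvne
    by_cases hu0 : u 0 = 0
    · have hu1 : u 1 ≠ 0 := hune.resolve_left (not_not.2 hu0)
      have hv1 : v 1 = 0 := by
        rw [hu0, zero_mul, zero_add] at horth
        exact (mul_eq_zero.1 horth).resolve_left hu1
      exact (indepOfOne_of_axes hE hA hv hu hv1 hu0 (hvne.resolve_right (not_not.2 hv1)) hu1).symm
    · by_cases hv0 : v 0 = 0
      · have hv1 : v 1 ≠ 0 := hvne.resolve_left (not_not.2 hv0)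
        have hu1 : u 1 = 0 := by
          rw [hv0, mul_zero, zero_add] at horth
          exact (mul_eq_zero.1 horth).resolve_right hv1
        exact indepOfOne_of_axes hE hA hu hv hu1 hv0 hu0 hv1
      · exact indepOfOne_of_index_le_two hE hA hjl (index_le_two hE hA hu hu0)
          (index_le_two hE hA hv hv0) hu hv

theorem tendsto_rescaled_curveFun_atTop (q : ℕ) :
    ∃ h, Tendsto (fun t => rescaled (curveFun (q + 5)) 0 (algE (curveFun (q + 5)) 0 (q + 5)) t h)
      (𝓝[>] 0) atTop := by
  have hT := tendsto_rescaled_third_fifth (isOrthDecomp_algE (by omega) (curveFun (q + 5)) 0)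
    (j := ⟨2, by omega⟩) (l := ⟨4, by omega⟩) rfl rfl
    (single_zero_mem_algE_curveFun (by omega)) (single_one_mem_algE_curveFun (by omega))
    (by simp) (by simp)
  refine ⟨EuclideanSpace.single 0 1 + EuclideanSpace.single 1 1, ?_⟩
  have hroot := tendsto_root_nhdsGT_zero (N := 30) (by norm_num)
  have hinv : Tendsto (fun t : ℝ => ((t ^ (1 / ((30 : ℕ) : ℝ))) ^ 2)⁻¹) (𝓝[>] 0) atTop := by
    refine tendsto_inv_nhdsGT_zero.comp (tendsto_nhdsWithin_iff.2 ⟨?_, ?_⟩)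
    · simpa using (hroot.mono_right nhdsWithin_le_nhds).pow 2
    · filter_upwards [self_mem_nhdsWithin] with t ht
      exact pow_pos (Real.rpow_pos_of_pos ht _) 2
  refine (hinv.atTop_mul_pos (by simp) hT).congr' ?_
  filter_upwards [self_mem_nhdsWithin] with t ht
  have : 0 < (t ^ (1 / ((30 : ℕ) : ℝ))) ^ 2 := pow_pos (Real.rpow_pos_of_pos ht _) 2
  rw [inv_mul_cancel_left₀ this.ne']

end

theorem mainTheorem1 :
    (∀ (d p : ℕ) (f : RSpace d → ℝ) (x : RSpace d), IsStrictPolyLocalMin p f x →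
      -- the algorithm yields an orthogonal decomposition
      IsOrthDecomp (algE f x p) ∧
      -- orders at most eight
      (p ≤ 4 →
        ConvergesOnCompacts f x (algE f x p) ∧
        ∀ B : RSpace d ≃ₗᵢ[ℝ] RSpace d, IsAdapted (algE f x p) B →
          (∀ h, Tendsto (fun t => rescaledCoord f x (algE f x p) B t h) (𝓝[>] 0)
            (𝓝 (limitPoly f x (algE f x p) (B h)))) ∧
          NonconstantInEachVariable (fun h => limitPoly f x (algE f x p) (B h))) ∧
      -- orders at least ten, for any orthogonal decomposition whose even cross terms vanish
      (5 ≤ p →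
        ∀ E : Fin p → Submodule ℝ (RSpace d), IsOrthDecomp E → EvenTermsVanish f x E →
          ConvergesOnCompacts f x E ∧
          ∀ B : RSpace d ≃ₗᵢ[ℝ] RSpace d, IsAdapted E B →
            ∀ h, Tendsto (fun t => rescaledCoord f x E B t h) (𝓝[>] 0)
              (𝓝 (limitPoly f x E (B h)))) ∧
      -- orders at least ten, for the decomposition of the algorithm
      (5 ≤ p → EvenTermsVanish f x (algE f x p) →
        ∀ B : RSpace d ≃ₗᵢ[ℝ] RSpace d, IsAdapted (algE f x p) B →
          NonconstantInEachVariable (fun h => limitPoly f x (algE f x p) (B h)))) ∧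
    -- at every order at least ten, suitable subspaces need not exist
    (∀ p : ℕ, 5 ≤ p →
      ∃ (d : ℕ) (f : RSpace d → ℝ) (x : RSpace d), IsStrictPolyLocalMin p f x ∧
        (∃ h, Tendsto (fun t => rescaled f x (algE f x p) t h) (𝓝[>] 0) atTop) ∧
        ¬ ∃ E : Fin p → Submodule ℝ (RSpace d), IsOrthDecomp E ∧ EvenTermsVanish f x E ∧
          ∀ B : RSpace d ≃ₗᵢ[ℝ] RSpace d, IsAdapted E B →
            NonconstantInEachVariable (fun h => limitPoly f x E (B h))) := by
  
  refine ⟨fun d p f x hx => ?_, fun p hp => ?_⟩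
  · have hp : p ≠ 0 := by have := hx.isLeast.1.1; omega
    have hE := isOrthDecomp_algE hp f x
    refine ⟨hE, fun hp4 => ?_, fun _ E hE hV => ?_, fun _ _ B hB =>
      nonconstantInEachVariable_algE hx hB⟩
    · have hA := convergesOnCompacts_of_evenTermsVanish hp hx.contDiff hx.isLocalMin hE
        (evenTermsVanish_algE_of_le_four hp4 hx.contDiff)
      exact ⟨hA, fun B hB => ⟨fun h => hA.tendsto_rescaledCoord hE hB h,
        nonconstantInEachVariable_algE hx hB⟩⟩
    · have hA := convergesOnCompacts_of_evenTermsVanish hp hx.contDiff hx.isLocalMin hE hV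
      exact ⟨hA, fun B hB h => hA.tendsto_rescaledCoord hE hB h⟩
  · obtain ⟨q, rfl⟩ : ∃ q, p = q + 5 := ⟨p - 5, by omega⟩
    exact ⟨2, curveFun (q + 5), 0, isStrictPolyLocalMin_curveFun (by omega),
      tendsto_rescaled_curveFun_atTop q, not_exists_decomp_curveFun q⟩
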